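/- Let $[0,1]$ be the standard MV-algebra, with $\neg a=1-a$, $a\oplus b=\min(1,a+b)$, $a\odot b=\max(0,a+b-1)$. Let $\mathcal I([0,1])$ be the algebra of type $(0,0,0,1,1,1,2,2)$ whose elements are the sets $[a,b]=\{\xi\mid a\le \xi\le b\}$ with $a\le b$ in $[0,1]$, with constants $0=[0,0]$, $1=[1,1]$, $\mathsf i=[0,1]$ and operations $$\neg x=\{\neg\alpha\mid\alpha\in x\},\quad \Delta x=[\min x,\min x],\quad \nabla x=[\max x,\max x],$$ $$x\oplus y=\{\alpha\oplus\beta\mid \alpha\in x,\ \beta\in y\},\quad x\odot y=\{\alpha\odot\beta\mid \alpha\in x,\ \beta\in y\}.$$ An IMV-algebra is an algebra $(J,0,1,\mathsf i,\neg,\Delta,\nabla,\oplus,\odot)$ of the same type satisfying the nineteen equations $$x\oplus(y\oplus z)=(x\oplus y)\oplus z,\quad x\oplus y=y\oplus x,\quad x\oplus 0=x,\quad x\oplus\neg 0=\neg 0,\quad \neg\neg x=x,$$ $$\neg(\neg\Delta x\oplus\Delta y)\oplus\Delta y=\neg(\neg\Delta y\oplus\Delta x)\oplus\Delta x,\quad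 x\odot y=\neg(\neg x\oplus\neg y),\quad 1=\neg 0,\quad \nabla x=\neg\Delta\neg x,\quad \neg\mathsf i=\mathsf i,$$ $$\Delta 0=0,\quad \Delta 1=1,\quad \Delta\mathsf i=0,\quad \Delta\Delta x=\Delta x,\quad \Delta\nabla x=\nabla x,$$ $$\Delta(x\oplus y)=\Delta x\oplus\Delta y,\quad \Delta(x\odot y)=\Delta x\odot\Delta y,\quad \Delta x\odot\neg\nabla x=0,\quad \Delta x\oplus(\mathsf i\odot\nabla x\odot\neg\Delta x)=x.$$ Let $\mathsf{IMV}$ be the class of all IMV-algebras. **Theorem (Equational completeness).** Let $\boldsymbol\Theta$ be the algebra with universe $\Theta=\{(a,b)\in[0,1]^2\mid a\le b\}$, constants $0=(0,0)$, $1=(1,1)$, $\mathsf i=(0,1)$ and operations $$\neg(a,b)=(\neg b,\neg a),\quad \Delta(a,b)=(a,a),\quad \nabla(a,b)=(b,b),$$ $$(a,b)\oplus(c,d)=(a\oplus c,b\oplus d),\quad (a,b)\odot(c,d)=(a\odot c,b\odot d).$$ Then $\mathcal I([0,1])$ and $\boldsymbol\Theta$ are IMV-algebras, and the map $[a,b]\mapsto(a,b)$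 is an isomorphism of $\mathcal I([0,1])$ onto $\boldsymbol\Theta$. Further, $$\mathsf{IMV}=\mathbb{HSP}(\mathcal I([0,1]))=\mathbb{HSP}(\boldsymbol\Theta),$$ where $\mathbb H$, $\mathbb S$, $\mathbb P$ denote the operators of forming homomorphic images, subalgebras, and direct products (of nonempty families), all up to isomorphism. Thus, for any two terms $p,q$ in the variables $X_0,X_1,X_2,\dots$, the following are equivalent: the equation $p=q$ holds in all IMV-algebras; $p=q$ holds in $\mathcal I([0,1])$; $p=q$ is derivable from the nineteen equations in Birkhoff equational logic, whose rules are reflexivity, symmetry, transitivity, replacement of an occurrence of a subterm by a provably equal term, and substitution of terms for variables. -/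

import Mathlib

open FirstOrder FirstOrder.Language

universe u v

namespace IMV

/-! ### The similarity type and its terms -/

/-- The operation symbols `0, 1, i, ¬, Δ, ∇, ⊕, ⊙`, of type `(0,0,0,1,1,1,2,2)`. -/
inductive Op : ℕ → Type
  | zero : Op 0
  | one : Op 0
  | iota : Op 0
  | neg : Op 1
  | delta : Op 1
  | nabla : Op 1
  | oplus : Op 2
  | odot : Op 2

/-- The purely algebraic language with the above operation symbols and no relation symbols.
Its structures are the algebras of this type, its homomorphisms `→[lang]` and isomorphisms
`≃[lang]` are the usual ones of universal algebra. -/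
def lang : FirstOrder.Language.{0, 0} := ⟨Op, fun _ => Empty⟩

/-- The algebra on `M` with the given operations. -/
@[reducible]
def algebraOfOps {M : Type u} (zero one iota : M) (neg delta nabla : M → M)
    (oplus odot : M → M → M) : lang.Structure M where
  funMap := fun {n} (f : Op n) =>
    match n, f with
    | _, .zero => fun _ => zero
    | _, .one => fun _ => one
    | _, .iota => fun _ => iota
    | _, .neg => fun x => neg (x 0)
    | _, .delta => fun x => delta (x 0)
    | _, .nabla => fun x => nabla (x 0)
    | _, .oplus => fun x => oplus (x 0) (x 1)
    | _, .odot => fun x => odot (x 0) (x 1)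
  RelMap := fun {_} r => Empty.elim r

/-- Terms in the variables `X₀, X₁, X₂, …`. -/
abbrev Tm : Type := lang.Term ℕ

/-- An equation is a pair of terms; `Holds A p q` says that `p = q` is satisfied in the
algebra `A`, that is, under all assignments of elements of `A` to the variables. -/
def Holds (A : Type u) [lang.Structure A] (p q : Tm) : Prop :=
  ∀ v : ℕ → A, p.realize v = q.realize v

section Terms

def tZero : Tm := Term.func (L := lang) Op.zero ![]
def tOne : Tm := Term.func (L := lang) Op.one ![]
def tIota : Tm := Term.func (L := lang) Op.iota ![]
def tNeg (s : Tm) : Tm := Term.func (L := lang) Op.neg ![s]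
def tDelta (s : Tm) : Tm := Term.func (L := lang) Op.delta ![s]
def tNabla (s : Tm) : Tm := Term.func (L := lang) Op.nabla ![s]
def tOplus (s t : Tm) : Tm := Term.func (L := lang) Op.oplus ![s, t]
def tOdot (s t : Tm) : Tm := Term.func (L := lang) Op.odot ![s, t]
def x : Tm := Term.var 0
def y : Tm := Term.var 1
def z : Tm := Term.var 2

local infixl:65 " ⊕ₜ " => tOplus
local infixl:70 " ⊙ₜ " => tOdot
local notation "𝟎" => tZero
local notation "𝟏" => tOne
local notation "𝐢" => tIota

/-- The nineteen defining equations of IMV-algebras. -/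
inductive Ax : Tm → Tm → Prop
  | oplus_assoc : Ax (x ⊕ₜ (y ⊕ₜ z)) ((x ⊕ₜ y) ⊕ₜ z)
  | oplus_comm : Ax (x ⊕ₜ y) (y ⊕ₜ x)
  | oplus_zero : Ax (x ⊕ₜ 𝟎) x
  | oplus_neg_zero : Ax (x ⊕ₜ tNeg 𝟎) (tNeg 𝟎)
  | neg_neg : Ax (tNeg (tNeg x)) x
  | mangani : Ax (tNeg (tNeg (tDelta x) ⊕ₜ tDelta y) ⊕ₜ tDelta y)
      (tNeg (tNeg (tDelta y) ⊕ₜ tDelta x) ⊕ₜ tDelta x)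
  | odot_eq : Ax (x ⊙ₜ y) (tNeg (tNeg x ⊕ₜ tNeg y))
  | one_eq : Ax 𝟏 (tNeg 𝟎)
  | nabla_eq : Ax (tNabla x) (tNeg (tDelta (tNeg x)))
  | neg_iota : Ax (tNeg 𝐢) 𝐢
  | delta_zero : Ax (tDelta 𝟎) 𝟎
  | delta_one : Ax (tDelta 𝟏) 𝟏
  | delta_iota : Ax (tDelta 𝐢) 𝟎
  | delta_delta : Ax (tDelta (tDelta x)) (tDelta x)
  | delta_nabla : Ax (tDelta (tNabla x)) (tNabla x)
  | delta_oplus : Ax (tDelta (x ⊕ₜ y)) (tDelta x ⊕ₜ tDelta y)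
  | delta_odot : Ax (tDelta (x ⊙ₜ y)) (tDelta x ⊙ₜ tDelta y)
  | order : Ax (tDelta x ⊙ₜ tNeg (tNabla x)) 𝟎
  | great : Ax (tDelta x ⊕ₜ (𝐢 ⊙ₜ tNabla x ⊙ₜ tNeg (tDelta x))) x

end Terms

/-- An IMV-algebra is an algebra satisfying the nineteen equations. -/
def IsIMVAlgebra (J : Type u) [lang.Structure J] : Prop :=
  ∀ p q : Tm, Ax p q → Holds J p q

/-! ### Birkhoff equational logic -/

/-- `Replace p q r s`: the term `s` results from `r` by replacing one occurrence of the
subterm `p` by `q`. -/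
inductive Replace (p q : Tm) : Tm → Tm → Prop
  | here : Replace p q p q
  | arg {n : ℕ} (f : lang.Functions n) (ts : Fin n → Tm) (i : Fin n) (s : Tm) :
      Replace p q (ts i) s →
        Replace p q (Term.func f ts) (Term.func f (Function.update ts i s))

/-- The equations derivable from the set `E` of equations in Birkhoff equational logic. -/
inductive Derivable (E : Tm → Tm → Prop) : Tm → Tm → Prop
  | ax (p q : Tm) : E p q → Derivable E p q
  | refl (p : Tm) : Derivable E p p
  | symm (p q : Tm) : Derivable E p q → Derivable E q p
  | trans (p q r : Tm) : Derivable E p q → Derivable E q r → Derivable E p r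
  | replacement (p q r s : Tm) : Derivable E p q → Replace p q r s → Derivable E r s
  | substitution (p q : Tm) (σ : ℕ → Tm) :
      Derivable E p q → Derivable E (p.subst σ) (q.subst σ)

/-! ### Class operators -/

/-- Direct products of algebras, with pointwise operations. -/
instance piAlgebra {ι : Type u} (A : ι → Type v) [∀ i, lang.Structure (A i)] :
    lang.Structure (∀ i, A i) where
  funMap f a i := Structure.funMap f (fun j => a j i)
  RelMap r _ := Empty.elim r

/-- Classes of algebras with universe of discourse `Type u`. -/
abbrev AlgClass : Type (u + 1) := Set (CategoryTheory.Bundled.{u} lang.Structure)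

/-- The class of all IMV-algebras. -/
def imvClass : AlgClass.{u} := {J | IsIMVAlgebra J}

/-- `H(K)`: the homomorphic images of members of `K`. -/
def classH (K : AlgClass.{u}) : AlgClass.{u} :=
  {A | ∃ B ∈ K, ∃ f : B →[lang] A, Function.Surjective f}

/-- `S(K)`: the (isomorphic copies of) subalgebras of members of `K`. -/
def classS (K : AlgClass.{u}) : AlgClass.{u} :=
  {A | ∃ B ∈ K, ∃ S : lang.Substructure B, Nonempty (A ≃[lang] S)}

/-- `P(K)`: the (isomorphic copies of) direct products of nonempty families in `K`. The index
set ranges over `Type u`, so that the products live in `Type (max u v)` when the members of `K`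
live in `Type v`. -/
def classP (K : AlgClass.{v}) : AlgClass.{max u v} :=
  {A | ∃ (ι : Type u) (_ : Nonempty ι) (B : ι → CategoryTheory.Bundled.{v} lang.Structure),
    (∀ i, B i ∈ K) ∧ Nonempty (A ≃[lang] (∀ i, B i))}

/-- `HSP(K)` for a class consisting of one algebra. -/
def classHSP (A : Type) [lang.Structure A] : AlgClass.{u} :=
  classH (classS (classP.{u, 0} {CategoryTheory.Bundled.of (c := lang.Structure) A}))

/-! ### The standard MV-algebra `[0,1]` -/

open unitInterval

/-- Truncated sum `a ⊕ b = min (1, a + b)`. -/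
def mvOplus (a b : I) : I :=
  ⟨min 1 (a + b), le_min zero_le_one (add_nonneg a.2.1 b.2.1), min_le_left _ _⟩

/-- Łukasiewicz conjunction `a ⊙ b = max (0, a + b - 1)`. -/
def mvOdot (a b : I) : I :=
  ⟨max 0 (a + b - 1), le_max_left _ _,
    max_le zero_le_one (by have := a.2.2; have := b.2.2; linarith)⟩

/-- Negation `¬ a = 1 - a`. -/
def mvNeg (a : I) : I :=
  ⟨1 - a, by have := a.2.2; linarith, by have := a.2.1; linarith⟩

theorem mvOplus_mono {a b c d : I} (h : a ≤ b) (k : c ≤ d) : mvOplus a c ≤ mvOplus b d :=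
  Subtype.coe_le_coe.1
    (min_le_min le_rfl (add_le_add (Subtype.coe_le_coe.2 h) (Subtype.coe_le_coe.2 k)))

theorem mvOdot_mono {a b c d : I} (h : a ≤ b) (k : c ≤ d) : mvOdot a c ≤ mvOdot b d :=
  Subtype.coe_le_coe.1 
    (max_le_max le_rfl
      (sub_le_sub_right (add_le_add (Subtype.coe_le_coe.2 h) (Subtype.coe_le_coe.2 k)) 1))

theorem mvNeg_anti {a b : I} (h : a ≤ b) : mvNeg b ≤ mvNeg a :=
  Subtype.coe_le_coe.1 (sub_le_sub_left (Subtype.coe_le_coe.2 h) 1)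

theorem mvNeg_mvNeg (a : I) : mvNeg (mvNeg a) = a :=
  Subtype.ext (sub_sub_cancel _ _)

theorem image2_Icc {f : I → I → I} (hf : Continuous fun p : I × I => f p.1 p.2)
    (mono : ∀ {a b c d : I}, a ≤ b → c ≤ d → f a c ≤ f b d) {a b c d : I}
    (h : a ≤ b) (k : c ≤ d) :
    Set.image2 f (Set.Icc a b) (Set.Icc c d) = Set.Icc (f a c) (f b d) := by
  apply Set.Subset.antisymm
  · rintro _ ⟨s, hs, t, ht, rfl⟩
    exact ⟨mono hs.1 ht.1, mono hs.2 ht.2⟩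
  · rw [← Set.image_prod]
    have hc : IsPreconnected ((fun p : I × I => f p.1 p.2) '' (Set.Icc a b ×ˢ Set.Icc c d)) :=
      (isPreconnected_Icc.prod isPreconnected_Icc).image _ hf.continuousOn
    exact hc.Icc_subset ⟨(a, c), ⟨⟨le_rfl, h⟩, ⟨le_rfl, k⟩⟩, rfl⟩
      ⟨(b, d), ⟨⟨h, le_rfl⟩, ⟨k, le_rfl⟩⟩, rfl⟩

theorem image2_mvOplus {a b c d : I} (h : a ≤ b) (k : c ≤ d) :
    Set.image2 mvOplus (Set.Icc a b) (Set.Icc c d) = Set.Icc (mvOplus a c) (mvOplus b d) :=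
  image2_Icc (by unfold mvOplus; fun_prop) mvOplus_mono h k

theorem image2_mvOdot {a b c d : I} (h : a ≤ b) (k : c ≤ d) :
    Set.image2 mvOdot (Set.Icc a b) (Set.Icc c d) = Set.Icc (mvOdot a c) (mvOdot b d) :=
  image2_Icc (by unfold mvOdot; fun_prop) mvOdot_mono h k

theorem image_mvNeg (a b : I) : mvNeg '' Set.Icc a b = Set.Icc (mvNeg b) (mvNeg a) := by
  apply Set.Subset.antisymm
  · rintro _ ⟨s, hs, rfl⟩
    exact ⟨mvNeg_anti hs.2, mvNeg_anti hs.1⟩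
  · intro s hs
    refine ⟨mvNeg s, ⟨?_, ?_⟩, mvNeg_mvNeg s⟩
    · simpa only [mvNeg_mvNeg] using mvNeg_anti hs.2
    · simpa only [mvNeg_mvNeg] using mvNeg_anti hs.1

/-! ### The algebra of intervals in `[0,1]` -/

/-- The set of intervals of `[0,1]`: the subsets `{ξ | a ≤ ξ ≤ b}` with `a ≤ b`. -/
def Interval : Type := {s : Set I // ∃ a b : I, a ≤ b ∧ s = Set.Icc a b}

namespace Interval

/-- The interval `[a,b]`. -/
def mk (a b : I) (h : a ≤ b) : Interval := ⟨Set.Icc a b, a, b, h, rfl⟩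

theorem exists_isLeast (s : Interval) : ∃ a, IsLeast s.1 a := by
  obtain ⟨s, a, b, h, rfl⟩ := s
  exact ⟨a, isLeast_Icc h⟩

theorem exists_isGreatest (s : Interval) : ∃ b, IsGreatest s.1 b := by
  obtain ⟨s, a, b, h, rfl⟩ := s
  exact ⟨b, isGreatest_Icc h⟩

/-- The minimum of an interval. -/
noncomputable def lo (s : Interval) : I := s.exists_isLeast.choose

/-- The maximum of an interval. -/
noncomputable def hi (s : Interval) : I := s.exists_isGreatest.choose

/-- Pointwise negation `{¬ α | α ∈ s}`. -/
def neg (s : Interval) : Interval :=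
  ⟨mvNeg '' s.1, by
    obtain ⟨s, a, b, h, rfl⟩ := s
    exact ⟨_, _, mvNeg_anti h, image_mvNeg a b⟩⟩

/-- Truncated Minkowski sum `{α ⊕ β | α ∈ s, β ∈ t}`. -/
def oplus (s t : Interval) : Interval :=
  ⟨Set.image2 mvOplus s.1 t.1, by
    obtain ⟨s, a, b, h, rfl⟩ := s
    obtain ⟨t, c, d, k, rfl⟩ := t
    exact ⟨_, _, mvOplus_mono h k, image2_mvOplus h k⟩⟩

/-- Pointwise conjunction `{α ⊙ β | α ∈ s, β ∈ t}`. -/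
def odot (s t : Interval) : Interval :=
  ⟨Set.image2 mvOdot s.1 t.1, by
    obtain ⟨s, a, b, h, rfl⟩ := s
    obtain ⟨t, c, d, k, rfl⟩ := t
    exact ⟨_, _, mvOdot_mono h k, image2_mvOdot h k⟩⟩

/-- The constant `i`: the interval consisting of all of `[0,1]`. -/
def whole : Interval := ⟨Set.univ, 0, 1, zero_le_one, Set.Icc_bot_top.symm⟩

/-- The algebra of all intervals in the standard MV-algebra `[0,1]`. -/
noncomputable instance : lang.Structure Interval :=
  algebraOfOps (mk 0 0 le_rfl) (mk 1 1 le_rfl) whole neg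
    (fun s => mk s.lo s.lo le_rfl) (fun s => mk s.hi s.hi le_rfl) oplus odot

end Interval

/-! ### The triangle algebra -/

/-- The triangle `{(a,b) ∈ [0,1]² | a ≤ b}`. -/
def Triangle : Type := {p : I × I // p.1 ≤ p.2}

namespace Triangle

/-- The point `(a,b)` of the triangle. -/
def mk (a b : I) (h : a ≤ b) : Triangle := ⟨(a, b), h⟩

instance : lang.Structure Triangle :=
  algebraOfOps (mk 0 0 le_rfl) (mk 1 1 le_rfl) (mk 0 1 zero_le_one)
    (fun p => mk (mvNeg p.1.2) (mvNeg p.1.1) (mvNeg_anti p.2))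
    (fun p => mk p.1.1 p.1.1 le_rfl)
    (fun p => mk p.1.2 p.1.2 le_rfl)
    (fun p q => mk (mvOplus p.1.1 q.1.1) (mvOplus p.1.2 q.1.2) (mvOplus_mono p.2 q.2))
    (fun p q => mk (mvOdot p.1.1 q.1.1) (mvOdot p.1.2 q.1.2) (mvOdot_mono p.2 q.2))

end Triangle

end IMV

/-! The heart of the matter is that an equation failing in some IMV-algebra already fails in the
triangle. The fixed points of `Δ` form an MV-algebra, and by the last equation an element is
determined by its images under `Δ` and `∇`, both of which lie there. Two distinct elements thus give
distinct elements of an MV-algebra. These are separated by a prime ideal, hence by a homomorphism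
into an MV-chain (`MVAlgebra.exists_chain_separating`), and Chang's construction makes the chain the
unit interval of a totally ordered abelian group (`ChainGroup`). The failing equation thereby fails
for pairs over such a group (`IsIMVAlgebra.exists_hom_pairs`).

Evaluating two terms at one assignment compares only finitely many group elements. By Hahn's
embedding theorem some homomorphism to the reals keeps finitely many positive elements positive
(`exists_addMonoidHom_real_pos`). Normalised to send the bound to 1, it carries the failure to the
triangle (`IsIMVAlgebra.exists_triangle_realize_ne`).

The rest is Birkhoff's argument. Every IMV-algebra is an image of an algebra of term functions
inside a power of the triangle, which gives HSP. Terms modulo provable equality form an IMV-algebra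
in which only derivable equations hold, which gives completeness of derivability. -/

/-! ### MV-algebras: order, lattice structure and cancellation. -/

/-- MV-algebras, with truncated sum `+` and negation `ᶜ`. -/
class MVAlgebra (A : Type u) extends AddCommMonoid A, Compl A where
  compl_compl' (a : A) : aᶜᶜ = a
  add_compl_zero' (a : A) : a + 0ᶜ = 0ᶜ
  mangani (a b : A) : (aᶜ + b)ᶜ + b = (bᶜ + a)ᶜ + a

namespace MVAlgebra

variable {A : Type u} [MVAlgebra A]

/-- Truncated difference. -/
instance : Sub A := ⟨fun a b => (aᶜ + b)ᶜ⟩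

theorem sub_def (a b : A) : a - b = (aᶜ + b)ᶜ := rfl

theorem compl_sub_compl (a b : A) : bᶜ - aᶜ = a - b := by
  rw [sub_def, sub_def, compl_compl', add_comm]

theorem sub_zero' (a : A) : a - 0 = a := by
  rw [sub_def, add_zero, compl_compl']

theorem zero_sub' (a : A) : 0 - a = 0 := by
  rw [sub_def, add_comm, add_compl_zero', compl_compl']

theorem sub_sub' (a b c : A) : a - b - c = a - (b + c) := by
  simp only [sub_def, compl_compl', add_assoc]

theorem sub_add_comm' (a b : A) : a - b + b = b - a + a := mangani a b

theorem compl_add_self' (a : A) : aᶜ + a = 0ᶜ := by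
  have := mangani (0ᶜ) a
  rw [compl_compl', zero_add, add_compl_zero'] at this
  exact this

theorem sub_self' (a : A) : a - a = 0 := by
  rw [sub_def, compl_add_self', compl_compl']

theorem self_sub_add' (a b : A) : a - (a + b) = 0 := by
  rw [← sub_sub', sub_self', zero_sub']

instance : PartialOrder A where
  le a b := a - b = 0
  le_refl := sub_self'
  le_antisymm a b h k := by
    have := sub_add_comm' a b
    rw [show a - b = 0 from h, show b - a = 0 from k, zero_add, zero_add] at this
    exact this.symm
  le_trans a b c h k := by
    have h1 := sub_add_comm' a b
    have h2 := sub_add_comm' b c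
    rw [show a - b = 0 from h, zero_add] at h1
    rw [show b - c = 0 from k, zero_add] at h2
    change a - c = 0
    rw [h2, h1, add_comm (b - a), add_left_comm, self_sub_add']

theorem le_iff_sub_eq_zero {a b : A} : a ≤ b ↔ a - b = 0 := Iff.rfl

theorem sub_add_cancel_of_le' {a b : A} (h : a ≤ b) : b - a + a = b := by
  rw [sub_add_comm', le_iff_sub_eq_zero.1 h, zero_add]

instance : IsOrderedAddMonoid A where
  add_le_add_left a b h c := by
    rw [le_iff_sub_eq_zero, ← sub_add_cancel_of_le' h, add_assoc, add_comm (b - a), self_sub_add']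

instance : CanonicallyOrderedAdd A where
  exists_add_of_le {a b} h := ⟨b - a, by rw [add_comm, sub_add_cancel_of_le' h]⟩
  le_self_add a b := self_sub_add' a b
  le_add_self a b := by rw [add_comm]; exact self_sub_add' a b

instance : OrderedSub A where
  tsub_le_iff_right a b c := by
    rw [le_iff_sub_eq_zero, le_iff_sub_eq_zero, sub_sub', add_comm]

/-- This is `mangani` read through complements; it makes the double difference symmetric, so that it
can serve as the infimum. -/
theorem sub_sub_comm' (a b : A) : a - (a - b) = b - (b - a) := by
  have h := mangani bᶜ aᶜ
  rw [compl_compl', compl_compl', add_comm b, add_comm a, add_comm _ aᶜ, add_comm _ bᶜ] at h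
  exact congrArg (·ᶜ) h

instance : Lattice A where
  sup a b := a - b + b
  le_sup_left a b := by
    exact le_tsub_add
  le_sup_right a b := le_add_self
  sup_le a b c h k := by
    rw [← tsub_add_cancel_of_le k]
    gcongr
  inf a b := a - (a - b)
  inf_le_left a b := tsub_le_self
  inf_le_right a b := by
    rw [sub_sub_comm']; exact tsub_le_self
  le_inf a b c h k := by
    calc a = b - (b - a) := by
            rw [sub_sub_comm', le_iff_sub_eq_zero.1 h, sub_zero']
      _ ≤ b - (b - c) := by gcongr

theorem sup_eq (a b : A) : a ⊔ b = a - b + b := rfl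

theorem inf_eq (a b : A) : a ⊓ b = a - (a - b) := rfl

theorem sup_sub_le (a b c : A) : (a ⊔ b) - c ≤ (a - c) ⊔ (b - c) := by
  rw [tsub_le_iff_right]
  exact sup_le (tsub_le_iff_right.1 le_sup_left) (tsub_le_iff_right.1 le_sup_right)

instance : DistribLattice A :=
  DistribLattice.ofInfSupLe fun a b c => by
    -- With the meet written as a double difference, the join splits off in the outer minuend by
    -- `sup_sub_le`; replacing the join by one of its parts in the subtrahend only enlarges the
    -- difference.
    rw [inf_comm, inf_eq]
    refine (sup_sub_le _ _ _).trans (sup_le_sup ?_ ?_)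
    · rw [inf_comm, inf_eq]
      exact tsub_le_tsub_left (tsub_le_tsub_right le_sup_left _) _
    · rw [inf_comm, inf_eq]
      exact tsub_le_tsub_left (tsub_le_tsub_right le_sup_right _) _

instance : BoundedOrder A where
  top := 0ᶜ
  le_top a := by
    rw [le_iff_sub_eq_zero, sub_def, add_compl_zero', compl_compl']
  bot := 0
  bot_le a := zero_sub' a

theorem top_eq : (⊤ : A) = 0ᶜ := rfl

theorem compl_top' : (⊤ : A)ᶜ = 0 := compl_compl' _

theorem top_add' (a : A) : ⊤ + a = ⊤ := by rw [add_comm]; exact add_compl_zero' a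

theorem add_top' (a : A) : a + ⊤ = ⊤ := add_compl_zero' a

theorem compl_le_iff {a b : A} : aᶜ ≤ b ↔ a + b = ⊤ := by
  rw [le_iff_sub_eq_zero, sub_def, compl_compl', top_eq]
  constructor
  · intro h; rw [← h, compl_compl']
  · intro h; rw [h, compl_compl']

theorem compl_le_compl' {a b : A} (h : a ≤ b) : bᶜ ≤ aᶜ := by
  rwa [le_iff_sub_eq_zero, compl_sub_compl]

/-- Truncation at `⊤` loses exactly what exceeds `bᶜ`, so summands below `bᶜ` cancel. -/
theorem add_sub_cancel_eq_inf (a b : A) : a + b - b = a ⊓ bᶜ := by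
  rw [inf_comm, inf_eq, sub_def bᶜ a, compl_compl', sub_def, sub_def, compl_compl', add_comm a,
    add_comm b (b + a)ᶜ]

theorem add_sub_cancel_of_le {a b : A} (h : a ≤ bᶜ) : a + b - b = a := by
  rw [add_sub_cancel_eq_inf, inf_eq_left.2 h]

theorem sub_le_compl (a b : A) : a - b ≤ bᶜ := by
  rw [tsub_le_iff_right, compl_add_self']; exact le_top

/-- Adding the meet `w` to `a ⊓ b` stays below both `a` and `b`, hence below `a ⊓ b`. As `w ≤ (a ⊓
b)ᶜ`, nothing is truncated and cancellation gives `w = 0`. This is what makes quotients by prime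
ideals total. -/
theorem sub_inf_sub (a b : A) : (a - b) ⊓ (b - a) = 0 := by
  set w := (a - b) ⊓ (b - a)
  have ha : a ⊓ b + (a - b) = a := by rw [inf_eq, tsub_add_cancel_of_le tsub_le_self]
  have hb : a ⊓ b + (b - a) = b := by
    rw [inf_comm, inf_eq, tsub_add_cancel_of_le tsub_le_self]
  have hw : a ⊓ b + w ≤ a ⊓ b := by
    refine le_inf ?_ ?_
    · conv_rhs => rw [← ha]
      exact add_le_add_right inf_le_left _
    · conv_rhs => rw [← hb]
      exact add_le_add_right inf_le_right _
  have hc : w ≤ (a ⊓ b)ᶜ := by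
    refine inf_le_left.trans ((sub_le_compl a b).trans (compl_le_compl' inf_le_right))
  rw [← add_sub_cancel_of_le hc, add_comm]
  exact le_iff_sub_eq_zero.1 hw

theorem add_inf_add_le (a b c : A) : (a + c) ⊓ (b + c) ≤ a ⊓ b + c := by
  rw [← tsub_le_iff_right]
  exact le_inf (tsub_le_iff_right.2 inf_le_left) (tsub_le_iff_right.2 inf_le_right)

/-! ### Prime ideals and separation by MV-chains. -/

/-- An ideal whose quotient is totally ordered. -/
structure IsPrimeIdeal (J : Set A) : Prop where
  zero_mem : 0 ∈ J
  add_mem {a b : A} : a ∈ J → b ∈ J → a + b ∈ J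
  mem_of_le {a b : A} : a ≤ b → b ∈ J → a ∈ J
  sub_mem_or (a b : A) : a - b ∈ J ∨ b - a ∈ J

/-- The prime ideal theorem for distributive lattices yields a lattice ideal avoiding `a`, but that
need not be closed under `+`; its stabiliser under addition is, and inherits primeness through
`sub_inf_sub`. -/
theorem exists_isPrimeIdeal_notMem {a : A} (ha : a ≠ 0) : ∃ J : Set A, IsPrimeIdeal J ∧ a ∉ J := by
  obtain ⟨P, hP, -, hPa⟩ := DistribLattice.prime_ideal_of_disjoint_filter_ideal
    (F := Order.PFilter.principal a) (I := Order.Ideal.principal (0 : A)) (by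
      rw [Set.disjoint_left]
      intro b hb hb'
      have h1 : a ≤ b := hb
      have h2 : b ≤ 0 := hb'
      exact ha (le_bot_iff.1 (h1.trans h2)))
  have haP : a ∉ P := fun h => Set.disjoint_left.1 hPa (show a ≤ a from le_rfl) h
  have h0 : (0 : A) ∈ P := P.bot_mem
  -- The elements whose translations preserve `P`; they lie in `P` because `0` does.
  refine ⟨{b | ∀ c ∈ P, b + c ∈ P}, ⟨fun c hc => by rwa [zero_add], ?_, ?_, ?_⟩, ?_⟩
  · intro b c hb hc d hd
    rw [add_assoc]
    exact hb _ (hc _ hd)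
  · intro b c hbc hc d hd
    exact P.lower (add_le_add_left hbc d) (hc d hd)
  · intro b c
    by_contra! h
    simp only [Set.mem_ofPred_eq, not_forall] at h
    obtain ⟨⟨d, hd, hd'⟩, e, he, he'⟩ := h
    -- A common witness for both failures, so that primeness of `P` can be applied to one meet.
    have hde : d ⊔ e ∈ P := Order.Ideal.sup_mem hd he
    have h1 : b - c + (d ⊔ e) ∉ P := fun h => hd' (P.lower (add_le_add_right le_sup_left _) h)
    have h2 : c - b + (d ⊔ e) ∉ P := fun h => he' (P.lower (add_le_add_right le_sup_right _) h)
    have h3 : (b - c + (d ⊔ e)) ⊓ (c - b + (d ⊔ e)) ∈ P := by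
      refine P.lower (add_inf_add_le _ _ _) ?_
      rwa [sub_inf_sub, zero_add]
    exact (hP.mem_or_mem h3).elim h1 h2
  · intro h
    exact haP (by simpa using h 0 h0)

/-- The congruence of an ideal. -/
def IsPrimeIdeal.setoid {J : Set A} (hJ : IsPrimeIdeal J) : Setoid A where
  r a b := a - b ∈ J ∧ b - a ∈ J
  iseqv :=
    ⟨fun a => by rw [sub_self']; exact ⟨hJ.zero_mem, hJ.zero_mem⟩, fun h => ⟨h.2, h.1⟩,
      fun h k => ⟨hJ.mem_of_le tsub_le_tsub_add_tsub (hJ.add_mem h.1 k.1),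
        hJ.mem_of_le tsub_le_tsub_add_tsub (hJ.add_mem k.2 h.2)⟩⟩

theorem add_sub_add_le' (a b c d : A) : a + b - (c + d) ≤ (a - c) + (b - d) := by
  rw [tsub_le_iff_right, add_add_add_comm]
  exact add_le_add le_tsub_add le_tsub_add

/-- The quotient of an MV-algebra by an ideal. -/
@[reducible]
def IsPrimeIdeal.quotient {J : Set A} (hJ : IsPrimeIdeal J) : MVAlgebra (Quotient hJ.setoid) :=
  letI : Zero (Quotient hJ.setoid) := ⟨Quotient.mk _ 0⟩
  letI : Add (Quotient hJ.setoid) := ⟨Quotient.map₂ (· + ·) fun _ _ h _ _ k =>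
    ⟨hJ.mem_of_le (add_sub_add_le' _ _ _ _) (hJ.add_mem h.1 k.1),
      hJ.mem_of_le (add_sub_add_le' _ _ _ _) (hJ.add_mem h.2 k.2)⟩⟩
  { compl := Quotient.map (·ᶜ) fun a b h => by
      change aᶜ - bᶜ ∈ J ∧ bᶜ - aᶜ ∈ J
      rw [compl_sub_compl, compl_sub_compl]
      exact ⟨h.2, h.1⟩
    nsmul := nsmulRec
    add_assoc := by
      rintro ⟨a⟩ ⟨b⟩ ⟨c⟩
      exact congrArg (Quotient.mk _) (add_assoc a b c)
    zero_add := by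
      rintro ⟨a⟩
      exact congrArg (Quotient.mk _) (zero_add a)
    add_zero := by
      rintro ⟨a⟩
      exact congrArg (Quotient.mk _) (add_zero a)
    add_comm := by
      rintro ⟨a⟩ ⟨b⟩
      exact congrArg (Quotient.mk _) (add_comm a b)
    compl_compl' := by
      rintro ⟨a⟩
      exact congrArg (Quotient.mk _) (compl_compl' a)
    add_compl_zero' := by
      rintro ⟨a⟩
      exact congrArg (Quotient.mk _) (add_compl_zero' a)
    mangani := by
      rintro ⟨a⟩ ⟨b⟩
      exact congrArg (Quotient.mk _) (mangani a b) }

end MVAlgebra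

/-- Totally ordered MV-algebras. -/
class MVChain (C : Type u) extends MVAlgebra C where
  le_total' (a b : C) : a ≤ b ∨ b ≤ a

/-- Distinct elements of an MV-algebra are separated by a homomorphism into an MV-chain. -/
theorem MVAlgebra.exists_chain_separating {A : Type u} [MVAlgebra A] {a b : A} (hab : a ≠ b) :
    ∃ (C : Type u) (_ : MVChain C) (h : A → C), h 0 = 0 ∧ (∀ x, h xᶜ = (h x)ᶜ) ∧
      (∀ x y, h (x + y) = h x + h y) ∧ h a ≠ h b := by
  wlog hab' : a - b ≠ 0 generalizing a b
  · obtain ⟨C, i, h, h0, h1, h2, h3⟩ := this hab.symm (fun h =>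
      hab (le_antisymm (le_iff_sub_eq_zero.2 (not_not.1 hab')) (le_iff_sub_eq_zero.2 h)))
    exact ⟨C, i, h, h0, h1, h2, h3.symm⟩
  obtain ⟨J, hJ, haJ⟩ := exists_isPrimeIdeal_notMem hab'
  let := hJ.quotient
  refine ⟨Quotient hJ.setoid, { hJ.quotient with le_total' := ?_ }, Quotient.mk _, rfl,
    fun _ => rfl, fun _ _ => rfl, ?_⟩
  · rintro ⟨x⟩ ⟨y⟩
    have key (x y : A) (h : x - y ∈ J) : (Quotient.mk hJ.setoid x) - Quotient.mk hJ.setoid y = 0 :=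
      Quotient.sound (s := hJ.setoid) (a := x - y) (b := 0)
        ⟨by rwa [sub_zero'], by rw [zero_sub']; exact hJ.zero_mem⟩
    exact (hJ.sub_mem_or x y).imp (key x y) (key y x)
  · intro h
    exact haJ (Quotient.exact h).1

/-! ### Mixed associativity of truncated sum and product. -/

namespace MVAlgebra

variable {A : Type u} [MVAlgebra A]

/-- The difference `a - bᶜ` is the product `a ⊙ b`: what remains of `a + b` beyond `⊤` when the sum
overflows. -/
theorem sub_compl_comm (a b : A) : a - bᶜ = b - aᶜ := by
  rw [sub_def, sub_def, add_comm]

theorem sub_compl_assoc (a b c : A) : a - bᶜ - cᶜ = a - (b - cᶜ)ᶜ := by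
  rw [sub_sub', sub_def b, compl_compl']

theorem le_compl_comm {a b : A} (h : a ≤ bᶜ) : b ≤ aᶜ := by
  rw [← compl_compl' b]; exact compl_le_compl' h

/-- Neither inner sum overflows. Subtracting `cᶜ` means subtracting `b` first, which cancels, and
then `cᶜ - b`. -/
theorem add_sub_compl_assoc {a b c : A} (h : a ≤ bᶜ) (k : b ≤ cᶜ) :
    a + b - cᶜ = a - (b + c)ᶜ := by
  conv_lhs => rw [← tsub_add_cancel_of_le k, add_comm (cᶜ - b) b, ← sub_sub',
    add_sub_cancel_of_le h]
  rw [sub_def cᶜ, compl_compl', add_comm c]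

theorem sub_compl_add {a b c : A} (h : aᶜ ≤ b) (k : b ≤ cᶜ) :
    a - bᶜ + c = a - (b + c)ᶜ := by
  rw [sub_compl_comm a b, sub_compl_comm a (b + c)]
  conv_rhs => rw [← tsub_add_cancel_of_le h, add_right_comm]
  rw [add_sub_cancel_of_le]
  rw [compl_compl']
  calc b - aᶜ + c ≤ b - aᶜ + bᶜ := add_le_add_right (le_compl_comm k) _
    _ = bᶜ ⊔ a := by
      rw [sub_compl_comm, ← sup_eq, sup_comm]
    _ ≤ a := sup_le (by rw [← compl_compl' a]; exact compl_le_compl' h) le_rfl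

/-- The complement of `add_sub_compl_assoc`, for the case where both inner sums overflow. -/
theorem sub_compl_add_eq_add_sub_compl {a b c : A} (h : aᶜ ≤ b) (k : bᶜ ≤ c) :
    a - bᶜ + c = a + (b - cᶜ) := by
  have := add_sub_compl_assoc (a := aᶜ) (b := bᶜ) (c := cᶜ) (by rwa [compl_compl'])
    (by rwa [compl_compl'])
  rw [compl_compl', sub_def, sub_def] at this
  rw [sub_def, sub_def]
  simpa only [compl_compl'] using congrArg (·ᶜ) this

end MVAlgebra

/-! ### Chang's group of an MV-chain. -/

namespace MVChain

open MVAlgebra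

variable {C : Type u} [MVChain C]

open Classical in
noncomputable instance : LinearOrder C :=
  letI : Std.Total (α := C) (· ≤ ·) := ⟨le_total'⟩
  Lattice.toLinearOrder C

theorem le_compl_of_add_ne_top {a b : C} (h : a + b ≠ ⊤) : a ≤ bᶜ := by
  rcases le_total a bᶜ with h1 | h1
  · exact h1
  · exact absurd (by rw [add_comm]; exact compl_le_iff.1 h1) h

open Classical in
/-- The carry of the addition modulo `⊤`. -/
noncomputable def carry (a b : C) : ℤ := if a + b = ⊤ then 1 else 0

open Classical in
/-- The sum modulo `⊤`. -/
noncomputable def rem (a b : C) : C := if a + b = ⊤ then a - bᶜ else a + b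

theorem carry_of_eq {a b : C} (h : a + b = ⊤) : carry a b = 1 := if_pos h
theorem carry_of_ne {a b : C} (h : a + b ≠ ⊤) : carry a b = 0 := if_neg h
theorem rem_of_eq {a b : C} (h : a + b = ⊤) : rem a b = a - bᶜ := if_pos h
theorem rem_of_ne {a b : C} (h : a + b ≠ ⊤) : rem a b = a + b := if_neg h

theorem carry_comm (a b : C) : carry a b = carry b a := by
  unfold carry; rw [add_comm]

theorem rem_comm (a b : C) : rem a b = rem b a := by
  unfold rem; rw [add_comm, sub_compl_comm]

theorem ne_top_of_le {a b : C} (h : a ≤ b) (hb : b ≠ ⊤) : a ≠ ⊤ :=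
  (h.trans_lt (lt_top_iff_ne_top.2 hb)).ne

theorem rem_ne_top {a b : C} (ha : a ≠ ⊤) : rem a b ≠ ⊤ := by
  unfold rem
  split_ifs with h
  · exact ne_top_of_le tsub_le_self ha
  · exact h

/-- The carry is a cocycle, which is what associativity in `ChainGroup` needs. If both inner sums
overflow, or neither does, the outer operations agree on the nose; if exactly one does, the total
carry is 1 on each side. -/
theorem carry_rem_assoc {a b c : C} (ha : a ≠ ⊤) (hc : c ≠ ⊤) :
    carry a b + carry (rem a b) c = carry b c + carry a (rem b c) ∧
      rem (rem a b) c = rem a (rem b c) := by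
  by_cases hab : a + b = ⊤ <;> by_cases hbc : b + c = ⊤
  · have key := sub_compl_add_eq_add_sub_compl (compl_le_iff.2 hab) (compl_le_iff.2 hbc)
    rw [carry_of_eq hab, carry_of_eq hbc, rem_of_eq hab, rem_of_eq hbc]
    unfold carry rem
    rw [key, sub_compl_assoc]
    exact ⟨rfl, rfl⟩
  · have key := sub_compl_add (compl_le_iff.2 hab) (le_compl_of_add_ne_top hbc)
    rw [carry_of_eq hab, carry_of_ne hbc, rem_of_eq hab, rem_of_ne hbc]
    have h1 : a - bᶜ + c ≠ ⊤ := by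
      rw [key]; exact ne_top_of_le tsub_le_self ha
    have h2 : a + (b + c) = ⊤ := by rw [← add_assoc, hab, top_add']
    rw [carry_of_ne h1, carry_of_eq h2, rem_of_ne h1, rem_of_eq h2, key]
    simp
  · have key := sub_compl_add (a := c) (b := b) (c := a) (compl_le_iff.2 (by rwa [add_comm]))
      (le_compl_of_add_ne_top (by rwa [add_comm]))
    rw [carry_of_ne hab, carry_of_eq hbc, rem_of_ne hab, rem_of_eq hbc, sub_compl_comm b c]
    have h1 : a + (c - bᶜ) ≠ ⊤ := by
      rw [add_comm, key]; exact ne_top_of_le tsub_le_self hc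
    have h2 : a + b + c = ⊤ := by rw [add_assoc, hbc, add_top']
    rw [carry_of_ne h1, carry_of_eq h2, rem_of_ne h1, rem_of_eq h2, add_comm a (c - bᶜ), key,
      sub_compl_comm, add_comm a]
    simp
  · have key := add_sub_compl_assoc (le_compl_of_add_ne_top hab) (le_compl_of_add_ne_top hbc)
    rw [carry_of_ne hab, carry_of_ne hbc, rem_of_ne hab, rem_of_ne hbc]
    unfold carry rem
    rw [key, add_assoc]
    exact ⟨rfl, rfl⟩

end MVChain

/-- The totally ordered group of an MV-chain: pairs of an integer part and a fractional part. -/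
@[ext]
structure ChainGroup (C : Type u) [MVChain C] where
  int : ℤ
  frac : C
  frac_ne : frac ≠ ⊤

namespace ChainGroup

open MVAlgebra MVChain

variable {C : Type u} [MVChain C]

noncomputable instance : Add (ChainGroup C) :=
  ⟨fun x y => ⟨x.int + y.int + carry x.frac y.frac, rem x.frac y.frac, rem_ne_top x.frac_ne⟩⟩

theorem add_int (x y : ChainGroup C) : (x + y).int = x.int + y.int + carry x.frac y.frac := rfl

theorem add_frac (x y : ChainGroup C) : (x + y).frac = rem x.frac y.frac := rfl

theorem zero_ne_top [Nontrivial C] : (0 : C) ≠ ⊤ := bot_ne_top (α := C)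

instance [Nontrivial C] : Zero (ChainGroup C) := ⟨⟨0, 0, zero_ne_top⟩⟩

theorem zero_int [Nontrivial C] : (0 : ChainGroup C).int = 0 := rfl

theorem zero_frac [Nontrivial C] : (0 : ChainGroup C).frac = 0 := rfl

theorem compl_ne_top {a : C} (h : a ≠ 0) : aᶜ ≠ ⊤ := fun k =>
  h (by rw [← compl_compl' a, k, compl_top'])

open Classical in
noncomputable instance [Nontrivial C] : Neg (ChainGroup C) :=
  -- A nonzero fractional part borrows one unit from the integer part; for fractional part `0` the
  -- complement would be the forbidden `⊤`.
  ⟨fun x => if h : x.frac = 0 then ⟨-x.int, 0, zero_ne_top⟩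
    else ⟨-x.int - 1, x.fracᶜ, compl_ne_top h⟩⟩

noncomputable instance [Nontrivial C] : AddCommGroup (ChainGroup C) where
  add_assoc x y z := by
    have h := carry_rem_assoc (b := y.frac) x.frac_ne z.frac_ne
    ext
    · simp only [add_int, add_frac]
      linarith [h.1]
    · exact h.2
  zero_add x := by
    have h : (0 : C) + x.frac ≠ ⊤ := by rw [zero_add]; exact x.frac_ne
    ext
    · rw [add_int, zero_frac, carry_of_ne h, zero_int]; simp
    · rw [add_frac, zero_frac, rem_of_ne h, zero_add]
  add_zero x := by
    have h : x.frac + 0 ≠ ⊤ := by rw [add_zero]; exact x.frac_ne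
    ext
    · rw [add_int, zero_frac, carry_of_ne h, zero_int]; simp
    · rw [add_frac, zero_frac, rem_of_ne h, add_zero]
  add_comm x y := by
    ext
    · rw [add_int, add_int, carry_comm, add_comm x.int]
    · rw [add_frac, add_frac, rem_comm]
  neg_add_cancel x := by
    by_cases h : x.frac = 0
    · have hn : -x = ⟨-x.int, 0, zero_ne_top⟩ := dif_pos h
      have h0 : (0 : C) + 0 ≠ ⊤ := by rw [zero_add]; exact zero_ne_top
      ext
      · simp only [hn, add_int, h, carry_of_ne h0, zero_int]; ring
      · simp only [hn, add_frac, h, rem_of_ne h0, zero_frac, add_zero]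
    · have hn : -x = ⟨-x.int - 1, x.fracᶜ, compl_ne_top h⟩ := dif_neg h
      have h0 : x.fracᶜ + x.frac = ⊤ := compl_add_self' _
      ext
      · simp only [hn, add_int, carry_of_eq h0, zero_int]; ring
      · simp only [hn, add_frac, rem_of_eq h0, zero_frac, sub_self']
  nsmul := nsmulRec
  zsmul := zsmulRec

noncomputable instance : LinearOrder (ChainGroup C) :=
  LinearOrder.lift' (fun x => toLex (x.int, x.frac)) fun x y h => by
    have h' := congrArg ofLex h
    exact ChainGroup.ext (congrArg Prod.fst h') (congrArg Prod.snd h')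

theorem le_iff {x y : ChainGroup C} :
    x ≤ y ↔ x.int < y.int ∨ x.int = y.int ∧ x.frac ≤ y.frac :=
  Prod.Lex.toLex_le_toLex

theorem carry_cases (a b : C) :
    a + b ≠ ⊤ ∧ carry a b = 0 ∧ rem a b = a + b ∨
      a + b = ⊤ ∧ carry a b = 1 ∧ rem a b = a - bᶜ := by
  by_cases h : a + b = ⊤
  · exact Or.inr ⟨h, carry_of_eq h, rem_of_eq h⟩
  · exact Or.inl ⟨h, carry_of_ne h, rem_of_ne h⟩

instance [Nontrivial C] : IsOrderedAddMonoid (ChainGroup C) where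
  add_le_add_left x y h z := by
    rw [le_iff] at h ⊢
    simp only [add_int, add_frac]
    -- A remainder after a carry lies below each summand, one without a carry above.
    have hx : carry x.frac z.frac = 1 → rem x.frac z.frac ≤ z.frac := by
      intro h
      rcases carry_cases x.frac z.frac with ⟨-, k, -⟩ | ⟨-, -, k⟩
      · omega
      · rw [k, sub_compl_comm]; exact tsub_le_self
    have hy : carry y.frac z.frac = 0 → z.frac ≤ rem y.frac z.frac := by
      intro h
      rcases carry_cases y.frac z.frac with ⟨-, -, k⟩ | ⟨-, k, -⟩
      · rw [k]; exact le_add_self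
      · omega
    rcases carry_cases x.frac z.frac with ⟨h1, h2, h3⟩ | ⟨h1, h2, h3⟩ <;>
    rcases carry_cases y.frac z.frac with ⟨k1, k2, k3⟩ | ⟨k1, k2, k3⟩ <;>
    rcases h with h | ⟨h, h'⟩
    · left; omega
    · right; refine ⟨by omega, ?_⟩
      rw [h3, k3]; exact add_le_add_left h' _
    · left; omega
    · left; omega
    -- Only the sum with `x` carries. If the integer parts differ by exactly one, the carry closes
    -- the gap and the remainders are compared through `z.frac`.
    · rcases (Int.add_one_le_iff.2 h).lt_or_eq with h | h
      · left; omega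
      · right; exact ⟨by omega, (hx h2).trans (hy k2)⟩
    · exact absurd (top_le_iff.1 (h1.symm.le.trans (add_le_add_left h' _))) k1
    · left; omega
    · right; refine ⟨by omega, ?_⟩
      rw [h3, k3]; exact tsub_le_tsub_right h' _

open Classical in
/-- The embedding of an MV-chain as the unit interval of its group. -/
noncomputable def of [Nontrivial C] (a : C) : ChainGroup C :=
  if h : a = ⊤ then ⟨1, 0, zero_ne_top⟩ else ⟨0, a, h⟩

variable [Nontrivial C]

theorem of_top : of (⊤ : C) = ⟨1, 0, zero_ne_top⟩ := dif_pos rfl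

theorem of_ne_top {a : C} (h : a ≠ ⊤) : of a = ⟨0, a, h⟩ := dif_neg h

theorem of_zero : of (0 : C) = 0 := of_ne_top _

theorem of_injective : Function.Injective (of : C → ChainGroup C) := by
  intro a b h
  by_cases ha : a = ⊤ <;> by_cases hb : b = ⊤
  · rw [ha, hb]
  · subst ha
    rw [of_top, of_ne_top hb] at h
    simp at h
  · subst hb
    rw [of_top, of_ne_top ha] at h
    simp at h
  · rw [of_ne_top ha, of_ne_top hb] at h
    exact congrArg frac h

theorem of_compl (a : C) : of aᶜ = of ⊤ - of a := by
  rw [eq_sub_iff_add_eq]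
  by_cases ha : a = ⊤
  · rw [ha, compl_top', of_zero, zero_add]
  by_cases h0 : a = 0
  · rw [h0, ← top_eq, of_zero, add_zero]
  have h := compl_add_self' a
  rw [of_ne_top ha, of_ne_top (compl_ne_top h0), of_top]
  ext
  · rw [add_int, carry_of_eq h]; rfl
  · rw [add_frac, rem_of_eq h, sub_self']

theorem of_add (a b : C) : of (a + b) = min (of ⊤) (of a + of b) := by
  have hnn (c : C) : 0 ≤ of c := by
    by_cases hc : c = ⊤
    · rw [hc, of_top, le_iff]; left; simp [zero_int]
    · rw [of_ne_top hc, le_iff]; right; exact ⟨rfl, bot_le⟩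
  by_cases ha : a = ⊤
  · rw [ha, top_add', min_eq_left (le_add_of_nonneg_right (hnn b))]
  by_cases hb : b = ⊤
  · rw [hb, add_top', min_eq_left (le_add_of_nonneg_left (hnn a))]
  by_cases h : a + b = ⊤
  · rw [h, min_eq_left]
    rw [of_top, of_ne_top ha, of_ne_top hb, le_iff, add_int, add_frac]
    right
    exact ⟨by simp [carry_of_eq h], bot_le⟩
  · have h1 : of (a + b) = of a + of b := by
      rw [of_ne_top ha, of_ne_top hb, of_ne_top h]
      ext
      · simp [add_int, carry_of_ne h]
      · simp [add_frac, rem_of_ne h]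
    rw [h1, min_eq_right]
    rw [← h1, of_ne_top h, of_top, le_iff]
    left; simp

end ChainGroup

/-- Distinct elements of an MV-algebra are separated by a homomorphism into the unit interval of a
totally ordered abelian group. -/
theorem MVAlgebra.exists_group_separating {A : Type u} [MVAlgebra A] {a b : A} (hab : a ≠ b) :
    ∃ (G : Type u) (_ : AddCommGroup G) (_ : LinearOrder G) (_ : IsOrderedAddMonoid G) (e : G)
      (g : A → G), g 0 = 0 ∧ (∀ x, g xᶜ = e - g x) ∧
        (∀ x y, g (x + y) = min e (g x + g y)) ∧ g a ≠ g b := by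
  obtain ⟨C, i, h, h0, h1, h2, h3⟩ := exists_chain_separating hab
  have : Nontrivial C := ⟨_, _, h3⟩
  refine ⟨ChainGroup C, inferInstance, inferInstance, inferInstance, ChainGroup.of ⊤,
    fun x => ChainGroup.of (h x), ?_, fun x => ?_, fun x y => ?_,
    ChainGroup.of_injective.ne h3⟩
  · beta_reduce; rw [h0, ChainGroup.of_zero]
  · beta_reduce; rw [h1, ChainGroup.of_compl]
  · beta_reduce; rw [h2, ChainGroup.of_add]

/-! ### Real-valued homomorphisms positive on finitely many elements. -/

/-- Finitely many positive Hahn series stay positive under a suitable weighted sum of finitely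
many coefficients. -/
theorem HahnSeries.exists_pos_weightedSum {Γ : Type u} [LinearOrder Γ]
    (S : Finset (Lex (HahnSeries Γ ℝ))) :
    ∃ f : Lex (HahnSeries Γ ℝ) →+ ℝ, ∀ s ∈ S, 0 < s → 0 < f s := by
  classical
  -- The leading exponents of the nonzero series in `S`.
  let T : Finset Γ := S.biUnion fun s => (ofLex s).orderTop.recTopCoe ∅ fun γ => {γ}
  let rank (γ : Γ) : ℕ := (T.filter (· < γ)).card
  have hrank {γ δ : Γ} (hγ : γ ∈ T) (h : γ < δ) : rank γ < rank δ := by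
    refine Finset.card_lt_card ⟨fun x hx => ?_, fun hsub => ?_⟩
    · rw [Finset.mem_filter] at hx ⊢
      exact ⟨hx.1, hx.2.trans h⟩
    · exact lt_irrefl _ (Finset.mem_filter.1 (hsub (Finset.mem_filter.2 ⟨hγ, h⟩))).2
  -- Weights decrease along `T` for small positive `t`, so the leading term dominates and decides
  -- the sign.
  let F (t : ℝ) (s : Lex (HahnSeries Γ ℝ)) : ℝ := ∑ γ ∈ T, t ^ rank γ * (ofLex s).coeff γ
  have key (s) (hs : s ∈ S) : ∀ᶠ t in nhdsWithin (0 : ℝ) (Set.Ioi 0), 0 < s → 0 < F t s := by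
    by_cases hpos : 0 < s
    swap
    · exact Filter.Eventually.of_forall fun _ h => absurd h hpos
    have hne : ofLex s ≠ 0 := fun h => hpos.ne' h
    obtain ⟨γ, hγ⟩ : ∃ γ : Γ, (ofLex s).orderTop = γ :=
      (WithTop.ne_top_iff_exists.1 (HahnSeries.orderTop_ne_top.2 hne)).imp fun _ h => h.symm
    have hγT : γ ∈ T := by
      refine Finset.mem_biUnion.2 ⟨s, hs, ?_⟩
      rw [hγ]; simp
    have hlc : 0 < (ofLex s).coeff γ := by
      have := HahnSeries.leadingCoeff_pos_iff.2 hpos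
      rwa [HahnSeries.leadingCoeff, hγ, WithTop.recTopCoe_coe] at this
    -- This is `F t s` with the leading weight divided out: a polynomial in `t` whose value at 0 is
    -- the positive leading coefficient.
    let g (t : ℝ) : ℝ := ∑ δ ∈ T.filter (γ ≤ ·), t ^ (rank δ - rank γ) * (ofLex s).coeff δ
    have hg0 : g 0 = (ofLex s).coeff γ := by
      refine (Finset.sum_eq_single γ ?_ ?_).trans ?_
      · intro δ hδ hne
        have h := hrank hγT (lt_of_le_of_ne (Finset.mem_filter.1 hδ).2 hne.symm)
        rw [zero_pow (by omega), zero_mul]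
      · intro h
        exact absurd (Finset.mem_filter.2 ⟨hγT, le_rfl⟩) h
      · simp
    have hgc : Continuous g := by fun_prop
    have hev : ∀ᶠ t in nhds (0 : ℝ), 0 < g t :=
      hgc.continuousAt.eventually (lt_mem_nhds (by rwa [hg0]))
    filter_upwards [nhdsWithin_le_nhds hev, self_mem_nhdsWithin] with t ht ht0 _
    have hF : F t s = t ^ rank γ * g t := by
      simp only [F, g]
      rw [Finset.mul_sum, Finset.sum_filter]
      refine Finset.sum_congr rfl fun δ _ => ?_
      split_ifs with h
      · have : rank γ ≤ rank δ := by
          rcases h.lt_or_eq with h | h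
          · exact (hrank hγT h).le
          · rw [h]
        obtain ⟨k, hk⟩ := Nat.exists_eq_add_of_le this
        rw [hk, Nat.add_sub_cancel_left]
        ring
      · rw [HahnSeries.coeff_eq_zero_of_lt_orderTop, mul_zero]
        rw [hγ]
        exact WithTop.coe_lt_coe.2 (not_le.1 h)
    rw [hF]
    exact mul_pos (pow_pos ht0 _) ht
  obtain ⟨t, ht⟩ := ((Filter.eventually_all_finset S).2 key).exists
  exact ⟨{ toFun := F t
           map_zero' := by simp [F]
           map_add' := fun a b => by simp [F, mul_add, Finset.sum_add_distrib] }, ht⟩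

/-- Finitely many positive elements of a totally ordered abelian group are positive under a
suitable real-valued homomorphism. -/
theorem exists_addMonoidHom_real_pos {G : Type u} [AddCommGroup G] [LinearOrder G]
    [IsOrderedAddMonoid G] (S : Finset G) : ∃ f : G →+ ℝ, ∀ s ∈ S, 0 < s → 0 < f s := by
  classical
  obtain ⟨e, he, -⟩ := hahnEmbedding_isOrderedAddMonoid G
  obtain ⟨f, hf⟩ := HahnSeries.exists_pos_weightedSum (S.image e)
  refine ⟨f.comp e.toAddMonoidHom, fun s hs h => hf _ (Finset.mem_image_of_mem _ hs) ?_⟩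
  have := (e.monotone'.strictMono_of_injective he) h
  simpa using this

/-! ### IMV-algebras: elementwise laws, skeleton and pairs. -/

namespace IMV

section Operations

variable {J : Type u} [lang.Structure J]

variable (J) in
/-- The constant `0`. -/
def opZero : J := Structure.funMap (L := lang) Op.zero ![]

variable (J) in
/-- The constant `1`. -/
def opOne : J := Structure.funMap (L := lang) Op.one ![]

variable (J) in
/-- The constant `i`. -/
def opIota : J := Structure.funMap (L := lang) Op.iota ![]

/-- The operation `¬`. -/
def opNeg (a : J) : J := Structure.funMap (L := lang) Op.neg ![a]

/-- The operation `Δ`. -/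
def opDelta (a : J) : J := Structure.funMap (L := lang) Op.delta ![a]

/-- The operation `∇`. -/
def opNabla (a : J) : J := Structure.funMap (L := lang) Op.nabla ![a]

/-- The operation `⊕`. -/
def opOplus (a b : J) : J := Structure.funMap (L := lang) Op.oplus ![a, b]

/-- The operation `⊙`. -/
def opOdot (a b : J) : J := Structure.funMap (L := lang) Op.odot ![a, b]

theorem funMap_zero (x : Fin 0 → J) : Structure.funMap (L := lang) Op.zero x = opZero J :=
  congrArg _ (Subsingleton.elim _ _)

theorem funMap_one (x : Fin 0 → J) : Structure.funMap (L := lang) Op.one x = opOne J :=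
  congrArg _ (Subsingleton.elim _ _)

theorem funMap_iota (x : Fin 0 → J) : Structure.funMap (L := lang) Op.iota x = opIota J :=
  congrArg _ (Subsingleton.elim _ _)

theorem funMap_neg (x : Fin 1 → J) : Structure.funMap (L := lang) Op.neg x = opNeg (x 0) :=
  congrArg _ (by ext i; fin_cases i; rfl)

theorem funMap_delta (x : Fin 1 → J) : Structure.funMap (L := lang) Op.delta x = opDelta (x 0) :=
  congrArg _ (by ext i; fin_cases i; rfl)

theorem funMap_nabla (x : Fin 1 → J) : Structure.funMap (L := lang) Op.nabla x = opNabla (x 0) :=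
  congrArg _ (by ext i; fin_cases i; rfl)

theorem funMap_oplus (x : Fin 2 → J) :
    Structure.funMap (L := lang) Op.oplus x = opOplus (x 0) (x 1) :=
  congrArg _ (by ext i; fin_cases i <;> rfl)

theorem funMap_odot (x : Fin 2 → J) :
    Structure.funMap (L := lang) Op.odot x = opOdot (x 0) (x 1) :=
  congrArg _ (by ext i; fin_cases i <;> rfl)

variable (v : ℕ → J) (s t : Tm)

theorem realize_tZero : tZero.realize v = opZero J := funMap_zero _
theorem realize_tOne : tOne.realize v = opOne J := funMap_one _
theorem realize_tIota : tIota.realize v = opIota J := funMap_iota _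
theorem realize_tNeg : (tNeg s).realize v = opNeg (s.realize v) := funMap_neg _
theorem realize_tDelta : (tDelta s).realize v = opDelta (s.realize v) := funMap_delta _
theorem realize_tNabla : (tNabla s).realize v = opNabla (s.realize v) := funMap_nabla _
theorem realize_tOplus :
    (tOplus s t).realize v = opOplus (s.realize v) (t.realize v) := funMap_oplus _
theorem realize_tOdot :
    (tOdot s t).realize v = opOdot (s.realize v) (t.realize v) := funMap_odot _
theorem realize_x : x.realize v = v 0 := rfl
theorem realize_y : y.realize v = v 1 := rfl
theorem realize_z : z.realize v = v 2 := rfl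

/-- The nineteen equations, for elements. -/
structure Laws (J : Type u) [lang.Structure J] : Prop where
  oplus_assoc (a b c : J) : opOplus a (opOplus b c) = opOplus (opOplus a b) c
  oplus_comm (a b : J) : opOplus a b = opOplus b a
  oplus_zero (a : J) : opOplus a (opZero J) = a
  oplus_neg_zero (a : J) : opOplus a (opNeg (opZero J)) = opNeg (opZero J)
  neg_neg (a : J) : opNeg (opNeg a) = a
  mangani (a b : J) :
    opOplus (opNeg (opOplus (opNeg (opDelta a)) (opDelta b))) (opDelta b) =
      opOplus (opNeg (opOplus (opNeg (opDelta b)) (opDelta a))) (opDelta a)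
  odot_eq (a b : J) : opOdot a b = opNeg (opOplus (opNeg a) (opNeg b))
  one_eq : opOne J = opNeg (opZero J)
  nabla_eq (a : J) : opNabla a = opNeg (opDelta (opNeg a))
  neg_iota : opNeg (opIota J) = opIota J
  delta_zero : opDelta (opZero J) = opZero J
  delta_one : opDelta (opOne J) = opOne J
  delta_iota : opDelta (opIota J) = opZero J
  delta_delta (a : J) : opDelta (opDelta a) = opDelta a
  delta_nabla (a : J) : opDelta (opNabla a) = opNabla a
  delta_oplus (a b : J) : opDelta (opOplus a b) = opOplus (opDelta a) (opDelta b)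
  delta_odot (a b : J) : opDelta (opOdot a b) = opOdot (opDelta a) (opDelta b)
  order (a : J) : opOdot (opDelta a) (opNeg (opNabla a)) = opZero J
  great (a : J) :
    opOplus (opDelta a) (opOdot (opOdot (opIota J) (opNabla a)) (opNeg (opDelta a))) = a

theorem IsIMVAlgebra.laws (hJ : IsIMVAlgebra J) : Laws J := by
  have key (a b c : J) {p q : Tm} (h : Ax p q) := hJ p q h fun n => Nat.casesOn n a
    fun m => Nat.casesOn m b fun _ => c
  constructor
  case oplus_assoc =>
    intro a b c
    have h := key a b c .oplus_assoc
    simp only [realize_tOplus, realize_x, realize_y, realize_z] at h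
    exact h
  case oplus_comm =>
    intro a b
    have h := key a b a .oplus_comm
    simp only [realize_tOplus, realize_x, realize_y] at h
    exact h
  case oplus_zero =>
    intro a
    have h := key a a a .oplus_zero
    simp only [realize_tOplus, realize_tZero, realize_x] at h
    exact h
  case oplus_neg_zero =>
    intro a
    have h := key a a a .oplus_neg_zero
    simp only [realize_tOplus, realize_tZero, realize_tNeg, realize_x] at h
    exact h
  case neg_neg =>
    intro a
    have h := key a a a .neg_neg
    simp only [realize_tNeg, realize_x] at h
    exact h
  case mangani =>
    intro a b
    have h := key a b a .mangani
    simp only [realize_tOplus, realize_tNeg, realize_tDelta, realize_x, realize_y] at h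
    exact h
  case odot_eq =>
    intro a b
    have h := key a b a .odot_eq
    simp only [realize_tOplus, realize_tNeg, realize_tOdot, realize_x, realize_y] at h
    exact h
  case one_eq =>
    have a := opZero J
    have h := key a a a .one_eq
    simp only [realize_tOne, realize_tNeg, realize_tZero] at h
    exact h
  case nabla_eq =>
    intro a
    have h := key a a a .nabla_eq
    simp only [realize_tNabla, realize_tNeg, realize_tDelta, realize_x] at h
    exact h
  case neg_iota =>
    have a := opZero J
    have h := key a a a .neg_iota
    simp only [realize_tIota, realize_tNeg] at h
    exact h
  case delta_zero =>
    have a := opZero J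
    have h := key a a a .delta_zero
    simp only [realize_tZero, realize_tDelta] at h
    exact h
  case delta_one =>
    have a := opZero J
    have h := key a a a .delta_one
    simp only [realize_tOne, realize_tDelta] at h
    exact h
  case delta_iota =>
    have a := opZero J
    have h := key a a a .delta_iota
    simp only [realize_tIota, realize_tDelta, realize_tZero] at h
    exact h
  case delta_delta =>
    intro a
    have h := key a a a .delta_delta
    simp only [realize_tDelta, realize_x] at h
    exact h
  case delta_nabla =>
    intro a
    have h := key a a a .delta_nabla
    simp only [realize_tDelta, realize_tNabla, realize_x] at h
    exact h
  case delta_oplus =>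
    intro a b
    have h := key a b a .delta_oplus
    simp only [realize_tDelta, realize_tOplus, realize_x, realize_y] at h
    exact h
  case delta_odot =>
    intro a b
    have h := key a b a .delta_odot
    simp only [realize_tDelta, realize_tOdot, realize_x, realize_y] at h
    exact h
  case order =>
    intro a
    have h := key a a a .order
    simp only [realize_tDelta, realize_tOdot, realize_tNeg, realize_tNabla, realize_tZero,
        realize_x] at h
    exact h
  case great =>
    intro a
    have h := key a a a .great
    simp only [realize_tDelta, realize_tOdot, realize_tOplus, realize_tNeg, realize_tNabla,
        realize_tIota, realize_x] at h
    exact h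

theorem Laws.isIMVAlgebra (hJ : Laws J) : IsIMVAlgebra J := by
  intro p q h v
  induction h <;> simp only [realize_tZero, realize_tOne, realize_tIota, realize_tNeg,
    realize_tDelta, realize_tNabla, realize_tOplus, realize_tOdot]
  case oplus_assoc => exact hJ.oplus_assoc _ _ _
  case oplus_comm => exact hJ.oplus_comm _ _
  case oplus_zero => exact hJ.oplus_zero _
  case oplus_neg_zero => exact hJ.oplus_neg_zero _
  case neg_neg => exact hJ.neg_neg _
  case mangani => exact hJ.mangani _ _
  case odot_eq => exact hJ.odot_eq _ _
  case one_eq => exact hJ.one_eq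
  case nabla_eq => exact hJ.nabla_eq _
  case neg_iota => exact hJ.neg_iota
  case delta_zero => exact hJ.delta_zero
  case delta_one => exact hJ.delta_one
  case delta_iota => exact hJ.delta_iota
  case delta_delta => exact hJ.delta_delta _
  case delta_nabla => exact hJ.delta_nabla _
  case delta_oplus => exact hJ.delta_oplus _ _
  case delta_odot => exact hJ.delta_odot _ _
  case order => exact hJ.order _
  case great => exact hJ.great _

end Operations

/-- The fixed points of `Δ`. -/
def Skeleton (J : Type u) [lang.Structure J] : Type u := {a : J // opDelta a = a}

namespace Laws

variable {J : Type u} [lang.Structure J]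

theorem neg_delta (hJ : Laws J) (a : J) : opNeg (opDelta a) = opNabla (opNeg a) := by
  rw [hJ.nabla_eq, hJ.neg_neg]

theorem delta_neg (hJ : Laws J) (a : J) : opDelta (opNeg a) = opNeg (opNabla a) := by
  rw [hJ.nabla_eq, hJ.neg_neg]

theorem delta_neg_of_delta (hJ : Laws J) {a : J} (h : opDelta a = a) :
    opDelta (opNeg a) = opNeg a := by
  rw [← h, hJ.neg_delta, hJ.delta_nabla]

theorem nabla_of_delta (hJ : Laws J) {a : J} (h : opDelta a = a) : opNabla a = a := by
  rw [hJ.nabla_eq, hJ.delta_neg_of_delta h, hJ.neg_neg]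

/-- As `∇` is the De Morgan dual of `Δ`, its compatibility with `⊕` comes from that of `Δ` with `⊙`,
and conversely. -/
theorem nabla_oplus (hJ : Laws J) (a b : J) :
    opNabla (opOplus a b) = opOplus (opNabla a) (opNabla b) := by
  have h : opNeg (opOplus a b) = opOdot (opNeg a) (opNeg b) := by
    rw [hJ.odot_eq, hJ.neg_neg, hJ.neg_neg]
  rw [hJ.nabla_eq, h, hJ.delta_odot, hJ.odot_eq, hJ.neg_neg, ← hJ.nabla_eq, ← hJ.nabla_eq]

theorem nabla_odot (hJ : Laws J) (a b : J) :
    opNabla (opOdot a b) = opOdot (opNabla a) (opNabla b) := by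
  rw [hJ.odot_eq, ← hJ.neg_delta, hJ.delta_oplus, hJ.delta_neg, hJ.delta_neg, hJ.odot_eq]

/-- The fixed points of `Δ` form an MV-algebra. -/
@[reducible]
def mvAlgebra (hJ : Laws J) : MVAlgebra (Skeleton J) :=
  letI : Zero (Skeleton J) := ⟨opZero J, hJ.delta_zero⟩
  letI : Add (Skeleton J) := ⟨fun a b => ⟨opOplus a.1 b.1, by rw [hJ.delta_oplus, a.2, b.2]⟩⟩
  { compl a := ⟨opNeg a.1, hJ.delta_neg_of_delta a.2⟩
    nsmul := nsmulRec
    add_assoc a b c := Subtype.ext (hJ.oplus_assoc _ _ _).symm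
    zero_add a := Subtype.ext ((hJ.oplus_comm _ _).trans (hJ.oplus_zero _))
    add_zero a := Subtype.ext (hJ.oplus_zero _)
    add_comm a b := Subtype.ext (hJ.oplus_comm _ _)
    compl_compl' a := Subtype.ext (hJ.neg_neg _)
    add_compl_zero' a := Subtype.ext (hJ.oplus_neg_zero _)
    mangani a b := Subtype.ext (by
      have := hJ.mangani a.1 b.1
      rwa [a.2, b.2] at this) }

end Laws

/-- Pairs of elements of a totally ordered abelian group, with the operations of intervals
relative to the bound `e`. -/
@[ext]
structure Pairs (G : Type u) (e : G) where
  lo : G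
  hi : G

instance (G : Type u) [AddCommGroup G] [LinearOrder G] (e : G) : lang.Structure (Pairs G e) :=
  algebraOfOps ⟨0, 0⟩ ⟨e, e⟩ ⟨0, e⟩ (fun p => ⟨e - p.hi, e - p.lo⟩) (fun p => ⟨p.lo, p.lo⟩)
    (fun p => ⟨p.hi, p.hi⟩) (fun p q => ⟨min e (p.lo + q.lo), min e (p.hi + q.hi)⟩)
    (fun p q => ⟨max 0 (p.lo + q.lo - e), max 0 (p.hi + q.hi - e)⟩)

/-- Distinct elements of an IMV-algebra are separated by a homomorphism into an algebra of
pairs over a totally ordered abelian group. -/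
theorem IsIMVAlgebra.exists_hom_pairs {J : Type u} [lang.Structure J] (h : IsIMVAlgebra J)
    {a b : J} (hab : a ≠ b) :
    ∃ (G : Type u) (_ : AddCommGroup G) (_ : LinearOrder G) (_ : IsOrderedAddMonoid G) (e : G)
      (f : J →[lang] Pairs G e), 0 < e ∧
        (∀ x, 0 ≤ (f x).lo ∧ (f x).lo ≤ (f x).hi ∧ (f x).hi ≤ e) ∧ f a ≠ f b := by
  have hJ := h.laws
  let := hJ.mvAlgebra
  let lo (x : J) : Skeleton J := ⟨opDelta x, hJ.delta_delta x⟩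
  let hi (x : J) : Skeleton J := ⟨opNabla x, hJ.delta_nabla x⟩
  -- By `great` an element is recovered from its `Δ` and `∇`, so `a` and `b` differ in one of them.
  have hsep : ∃ c d : Skeleton J, c ≠ d ∧ (c = lo a ∧ d = lo b ∨ c = hi a ∧ d = hi b) := by
    by_cases h1 : lo a = lo b
    · refine ⟨hi a, hi b, fun h2 => hab ?_, Or.inr ⟨rfl, rfl⟩⟩
      rw [← hJ.great a, ← hJ.great b, show opDelta a = opDelta b from congrArg Subtype.val h1,
        show opNabla a = opNabla b from congrArg Subtype.val h2]
    · exact ⟨lo a, lo b, h1, Or.inl ⟨rfl, rfl⟩⟩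
  obtain ⟨c, d, hcd, hcases⟩ := hsep
  obtain ⟨G, i1, i2, i3, e, g, g0, gc, ga, gne⟩ := MVAlgebra.exists_group_separating hcd
  have gle (x) : g x ≤ e := by
    rw [← add_zero x, ga]; exact min_le_left _ _
  have gnn (x) : 0 ≤ g x := by
    have := gle xᶜ
    rw [gc] at this
    exact (sub_le_self_iff e).1 this
  have gmono {x y} (hxy : x ≤ y) : g x ≤ g y := by
    rw [← tsub_add_cancel_of_le hxy, ga]
    exact le_min (gle x) (le_add_of_nonneg_left (gnn _))
  have gone : g (0ᶜ) = e := by rw [gc, g0, sub_zero]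
  have godot (x y) : g ((xᶜ + yᶜ)ᶜ) = max 0 (g x + g y - e) := by
    rw [gc, ga, gc, gc, ← max_sub_sub_left, sub_self]
    congr 1; abel
  have hlohi (x : J) : lo x ≤ hi x := by
    refine Subtype.ext ?_
    have := hJ.order x
    rwa [hJ.odot_eq, hJ.neg_neg] at this
  have hzero : lo (opZero J) = 0 := Subtype.ext hJ.delta_zero
  have hzero' : hi (opZero J) = 0 := Subtype.ext (hJ.nabla_of_delta hJ.delta_zero)
  have hone : lo (opOne J) = 0ᶜ := Subtype.ext (hJ.delta_one.trans hJ.one_eq)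
  have hone' : hi (opOne J) = 0ᶜ :=
    Subtype.ext ((hJ.nabla_of_delta hJ.delta_one).trans hJ.one_eq)
  have hiota : lo (opIota J) = 0 := Subtype.ext hJ.delta_iota
  have hiota' : hi (opIota J) = 0ᶜ := Subtype.ext (by
    change opNabla (opIota J) = opNeg (opZero J)
    rw [hJ.nabla_eq, hJ.neg_iota, hJ.delta_iota])
  have hneg (x : J) : lo (opNeg x) = (hi x)ᶜ := Subtype.ext (hJ.delta_neg x)
  have hneg' (x : J) : hi (opNeg x) = (lo x)ᶜ := Subtype.ext (hJ.neg_delta x).symm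
  have hdelta (x : J) : lo (opDelta x) = lo x := Subtype.ext (hJ.delta_delta x)
  have hdelta' (x : J) : hi (opDelta x) = lo x :=
    Subtype.ext (hJ.nabla_of_delta (hJ.delta_delta x))
  have hnabla (x : J) : lo (opNabla x) = hi x := Subtype.ext (hJ.delta_nabla x)
  have hnabla' (x : J) : hi (opNabla x) = hi x :=
    Subtype.ext (hJ.nabla_of_delta (hJ.delta_nabla x))
  have hoplus (x y : J) : lo (opOplus x y) = lo x + lo y := Subtype.ext (hJ.delta_oplus x y)
  have hoplus' (x y : J) : hi (opOplus x y) = hi x + hi y := Subtype.ext (hJ.nabla_oplus x y)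
  have hodot (x y : J) : lo (opOdot x y) = ((lo x)ᶜ + (lo y)ᶜ)ᶜ :=
    Subtype.ext ((hJ.delta_odot x y).trans (hJ.odot_eq _ _))
  have hodot' (x y : J) : hi (opOdot x y) = ((hi x)ᶜ + (hi y)ᶜ)ᶜ :=
    Subtype.ext ((hJ.nabla_odot x y).trans (hJ.odot_eq _ _))
  let F (x : J) : Pairs G e := ⟨g (lo x), g (hi x)⟩
  have hF {n : ℕ} (f : lang.Functions n) (x : Fin n → J) :
      F (Structure.funMap f x) = Structure.funMap f (F ∘ x) := by
    cases f
    case zero =>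
      rw [funMap_zero]
      exact Pairs.ext ((congrArg g hzero).trans g0)
        ((congrArg g hzero').trans g0)
    case one =>
      rw [funMap_one]
      exact Pairs.ext ((congrArg g hone).trans gone)
        ((congrArg g hone').trans gone)
    case iota =>
      rw [funMap_iota]
      exact Pairs.ext ((congrArg g hiota).trans g0)
        ((congrArg g hiota').trans gone)
    case neg =>
      rw [funMap_neg]
      exact Pairs.ext ((congrArg g (hneg _)).trans (gc _))
        ((congrArg g (hneg' _)).trans (gc _))
    case delta =>
      rw [funMap_delta]
      exact Pairs.ext (congrArg g (hdelta _))
        (congrArg g (hdelta' _))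
    case nabla =>
      rw [funMap_nabla]
      exact Pairs.ext (congrArg g (hnabla _))
        (congrArg g (hnabla' _))
    case oplus =>
      rw [funMap_oplus]
      exact Pairs.ext ((congrArg g (hoplus _ _)).trans (ga _ _))
        ((congrArg g (hoplus' _ _)).trans (ga _ _))
    case odot =>
      rw [funMap_odot]
      exact Pairs.ext ((congrArg g (hodot _ _)).trans (godot _ _))
        ((congrArg g (hodot' _ _)).trans (godot _ _))
  refine ⟨G, i1, i2, i3, e, ⟨F, hF, fun r => Empty.elim r⟩, ?_,
    fun x => ⟨gnn _, gmono (hlohi x), gle _⟩, fun hab => ?_⟩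
  -- If `e` were 0, all values of `g` would vanish and nothing would be separated.
  · refine lt_of_le_of_ne ((gnn 0).trans (gle 0)) fun he => gne ?_
    rw [le_antisymm ((gle c).trans he.symm.le) (gnn c),
      le_antisymm ((gle d).trans he.symm.le) (gnn d)]
  · rcases hcases with ⟨rfl, rfl⟩ | ⟨rfl, rfl⟩
    · exact gne (congrArg Pairs.lo hab)
    · exact gne (congrArg Pairs.hi hab)

end IMV

/-! ### Transfer of failing equations to the triangle. -/

namespace IMV

/-- The element of the triangle nearest to a pair of reals. -/
noncomputable def clamp (a b : ℝ) : Triangle :=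
  Triangle.mk (Set.projIcc 0 1 zero_le_one a)
    (max (Set.projIcc 0 1 zero_le_one a) (Set.projIcc 0 1 zero_le_one b)) (le_max_left _ _)

theorem clamp_fst {a b : ℝ} (h : 0 ≤ a) (hab : a ≤ b) (k : b ≤ 1) :
    ((clamp a b).1.1 : ℝ) = a := by
  change ((Set.projIcc 0 1 zero_le_one a : Set.Icc (0 : ℝ) 1) : ℝ) = a
  rw [Set.projIcc_of_mem zero_le_one ⟨h, hab.trans k⟩]

theorem clamp_snd {a b : ℝ} (h : 0 ≤ a) (hab : a ≤ b) (k : b ≤ 1) :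
    ((clamp a b).1.2 : ℝ) = b := by
  have hmax := max_eq_right (Set.monotone_projIcc (zero_le_one' ℝ) hab)
  exact (congrArg Subtype.val hmax).trans
    (congrArg Subtype.val (Set.projIcc_of_mem (zero_le_one' ℝ) ⟨h.trans hab, k⟩))

section Transfer

variable {G : Type u} [AddCommGroup G] [LinearOrder G]

theorem map_nonneg_of_pos_imp {φ : G →+ ℝ} {a : G} (h : 0 < a → 0 < φ a) (ha : 0 ≤ a) :
    0 ≤ φ a := by
  rcases ha.lt_or_eq with ha | ha
  · exact (h ha).le
  · rw [← ha, map_zero]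

variable [IsOrderedAddMonoid G]

/-- No monotonicity of `φ` is needed: the two differences alone decide which argument is smaller. -/
theorem map_min_of_pos_imp {φ : G →+ ℝ} {a b : G} (h : 0 < a - b → 0 < φ (a - b))
    (k : 0 < b - a → 0 < φ (b - a)) : φ (min a b) = min (φ a) (φ b) := by
  rcases le_total a b with hab | hab
  · have := map_nonneg_of_pos_imp k (sub_nonneg.2 hab)
    rw [map_sub, sub_nonneg] at this
    rw [min_eq_left hab, min_eq_left this]
  · have := map_nonneg_of_pos_imp h (sub_nonneg.2 hab)
    rw [map_sub, sub_nonneg] at this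
    rw [min_eq_right hab, min_eq_right this]

theorem map_max_of_pos_imp {φ : G →+ ℝ} {a b : G} (h : 0 < a - b → 0 < φ (a - b))
    (k : 0 < b - a → 0 < φ (b - a)) : φ (max a b) = max (φ a) (φ b) := by
  rcases le_total a b with hab | hab
  · have := map_nonneg_of_pos_imp k (sub_nonneg.2 hab)
    rw [map_sub, sub_nonneg] at this
    rw [max_eq_right hab, max_eq_right this]
  · have := map_nonneg_of_pos_imp h (sub_nonneg.2 hab)
    rw [map_sub, sub_nonneg] at this
    rw [max_eq_left hab, max_eq_left this]

/-- The value of a term in an algebra of pairs is mapped to a value of the term in the triangle by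
every real-valued homomorphism that preserves the signs of certain finitely many elements. -/
theorem exists_finset_realize_clamp {α : Type v} {e : G} (w : α → Pairs G e)
    (hw : ∀ i, 0 ≤ (w i).lo ∧ (w i).lo ≤ (w i).hi ∧ (w i).hi ≤ e) (t : lang.Term α) :
    ∃ S : Finset G, ∀ φ : G →+ ℝ, φ e = 1 → (∀ s ∈ S, 0 < s → 0 < φ s) →
      ((t.realize fun i => clamp (φ (w i).lo) (φ (w i).hi)).1.1 : ℝ) = φ (t.realize w).lo ∧
      ((t.realize fun i => clamp (φ (w i).lo) (φ (w i).hi)).1.2 : ℝ) = φ (t.realize w).hi := by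
  classical
  induction t with
  | var i =>
    -- These signs place the images in order between 0 and 1, where clamping changes nothing.
    refine ⟨{(w i).lo, (w i).hi - (w i).lo, e - (w i).hi}, fun φ he hS => ?_⟩
    have h1 := map_nonneg_of_pos_imp (hS (w i).lo (by simp)) (hw i).1
    have h2 := map_nonneg_of_pos_imp (hS ((w i).hi - (w i).lo) (by simp))
      (sub_nonneg.2 (hw i).2.1)
    have h3 := map_nonneg_of_pos_imp (hS (e - (w i).hi) (by simp)) (sub_nonneg.2 (hw i).2.2)
    rw [map_sub, sub_nonneg] at h2 h3
    rw [he] at h3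
    exact ⟨clamp_fst h1 h2 h3, clamp_snd h1 h2 h3⟩
  | @func n f ts ih =>
    choose S hS using ih
    cases f
    case zero => exact ⟨∅, fun φ _ _ => ⟨(map_zero φ).symm, (map_zero φ).symm⟩⟩
    case one => exact ⟨∅, fun φ he _ => ⟨he.symm, he.symm⟩⟩
    case iota => exact ⟨∅, fun φ he _ => ⟨(map_zero φ).symm, he.symm⟩⟩
    case neg =>
      refine ⟨S 0, fun φ he h => ?_⟩
      obtain ⟨h1, h2⟩ := hS 0 φ he h
      refine ⟨Eq.trans ?_ (map_sub φ _ _).symm, Eq.trans ?_ (map_sub φ _ _).symm⟩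
      · rw [he]; exact congrArg (1 - ·) h2
      · rw [he]; exact congrArg (1 - ·) h1
    case delta =>
      refine ⟨S 0, fun φ he h => ?_⟩
      obtain ⟨h1, h2⟩ := hS 0 φ he h
      exact ⟨h1, h1⟩
    case nabla =>
      refine ⟨S 0, fun φ he h => ?_⟩
      obtain ⟨h1, h2⟩ := hS 0 φ he h
      exact ⟨h2, h2⟩
    case oplus =>
      let p := (ts 0).realize w
      let q := (ts 1).realize w
      -- Besides the elements needed by the subterms, the differences whose signs decide the
      -- truncation at `e`.
      refine ⟨S 0 ∪ S 1 ∪ {e - (p.lo + q.lo), p.lo + q.lo - e, e - (p.hi + q.hi),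
        p.hi + q.hi - e}, fun φ he h => ?_⟩
      obtain ⟨h1, h2⟩ := hS 0 φ he fun s hs => h s (by simp [hs])
      obtain ⟨k1, k2⟩ := hS 1 φ he fun s hs => h s (by simp [hs])
      have m1 := map_min_of_pos_imp (h (e - (p.lo + q.lo)) (by simp))
        (h (p.lo + q.lo - e) (by simp))
      have m2 := map_min_of_pos_imp (h (e - (p.hi + q.hi)) (by simp))
        (h (p.hi + q.hi - e) (by simp))
      rw [he, map_add] at m1 m2
      exact ⟨(congrArg (min 1) (congrArg₂ (· + ·) h1 k1)).trans m1.symm,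
        (congrArg (min 1) (congrArg₂ (· + ·) h2 k2)).trans m2.symm⟩
    case odot =>
      let p := (ts 0).realize w
      let q := (ts 1).realize w
      refine ⟨S 0 ∪ S 1 ∪ {0 - (p.lo + q.lo - e), p.lo + q.lo - e - 0, 0 - (p.hi + q.hi - e),
        p.hi + q.hi - e - 0}, fun φ he h => ?_⟩
      obtain ⟨h1, h2⟩ := hS 0 φ he fun s hs => h s (by simp [hs])
      obtain ⟨k1, k2⟩ := hS 1 φ he fun s hs => h s (by simp [hs])
      have m1 := map_max_of_pos_imp (h (0 - (p.lo + q.lo - e)) (by simp))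
        (h (p.lo + q.lo - e - 0) (by simp))
      have m2 := map_max_of_pos_imp (h (0 - (p.hi + q.hi - e)) (by simp))
        (h (p.hi + q.hi - e - 0) (by simp))
      rw [map_zero, map_sub, he, map_add] at m1 m2
      exact ⟨(congrArg (fun r => max 0 (r - 1)) (congrArg₂ (· + ·) h1 k1)).trans m1.symm,
        (congrArg (fun r => max 0 (r - 1)) (congrArg₂ (· + ·) h2 k2)).trans m2.symm⟩

end Transfer

/-- An equation that fails in some IMV-algebra fails in the triangle algebra. -/
theorem IsIMVAlgebra.exists_triangle_realize_ne {J : Type u} [lang.Structure J]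
    (hJ : IsIMVAlgebra J) {α : Type v} {p q : lang.Term α} {w : α → J}
    (hne : p.realize w ≠ q.realize w) : ∃ w' : α → Triangle, p.realize w' ≠ q.realize w' := by
  classical
  obtain ⟨G, _, _, _, e, f, he, hf, hfne⟩ := hJ.exists_hom_pairs hne
  rw [← HomClass.realize_term, ← HomClass.realize_term] at hfne
  obtain ⟨S, hS⟩ := exists_finset_realize_clamp (f ∘ w) (fun i => hf (w i)) p
  obtain ⟨T, hT⟩ := exists_finset_realize_clamp (f ∘ w) (fun i => hf (w i)) q
  let P := p.realize (f ∘ w)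
  let Q := q.realize (f ∘ w)
  -- The sets `S` and `T` make evaluation commute with the map, `e` permits rescaling, and the four
  -- differences keep the unequal values unequal.
  obtain ⟨φ, hφ⟩ := exists_addMonoidHom_real_pos
    (S ∪ T ∪ {e, P.lo - Q.lo, Q.lo - P.lo, P.hi - Q.hi, Q.hi - P.hi})
  have hφe : 0 < φ e := hφ e (by simp) he
  let ψ : G →+ ℝ := (AddMonoidHom.mulLeft (φ e)⁻¹).comp φ
  have hψe : ψ e = 1 := inv_mul_cancel₀ hφe.ne'
  have hψ (s) (hs : s ∈ S ∪ T ∪ {e, P.lo - Q.lo, Q.lo - P.lo, P.hi - Q.hi, Q.hi - P.hi})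
      (h : 0 < s) : 0 < ψ s := mul_pos (inv_pos.2 hφe) (hφ s hs h)
  have hinj {a b : G} (h1 : 0 < a - b → 0 < ψ (a - b)) (h2 : 0 < b - a → 0 < ψ (b - a))
      (h : ψ a = ψ b) : a = b := by
    by_contra hab
    rcases lt_or_gt_of_ne hab with hab | hab
    · have := h2 (sub_pos.2 hab)
      rw [map_sub, h, sub_self] at this
      exact this.false
    · have := h1 (sub_pos.2 hab)
      rw [map_sub, h, sub_self] at this
      exact this.false
  obtain ⟨h1, h2⟩ := hS ψ hψe fun s hs => hψ s (by simp [hs])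
  obtain ⟨k1, k2⟩ := hT ψ hψe fun s hs => hψ s (by simp [hs])
  refine ⟨fun i => clamp (ψ (f (w i)).lo) (ψ (f (w i)).hi), fun h => hfne (Pairs.ext ?_ ?_)⟩
  · refine hinj (hψ (P.lo - Q.lo) (by simp)) (hψ (Q.lo - P.lo) (by simp)) (h1.symm.trans ?_)
    exact (congrArg (fun r : Triangle => (r.1.1 : ℝ)) h).trans k1
  · refine hinj (hψ (P.hi - Q.hi) (by simp)) (hψ (Q.hi - P.hi) (by simp)) (h2.symm.trans ?_)
    exact (congrArg (fun r : Triangle => (r.1.2 : ℝ)) h).trans k2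

/-! ### The triangle as an IMV-algebra, and its isomorphism with the intervals. -/

theorem Triangle.ext' {p q : Triangle} (h : (p.1.1 : ℝ) = q.1.1) (k : (p.1.2 : ℝ) = q.1.2) :
    p = q :=
  Subtype.ext (Prod.ext (Subtype.ext h) (Subtype.ext k))

theorem min_one_add_assoc {a b c : ℝ} (ha : 0 ≤ a) (hc : 0 ≤ c) :
    min 1 (a + min 1 (b + c)) = min 1 (min 1 (a + b) + c) := by
  simp only [min_def]; split_ifs <;> linarith

/-- It turns both sides of `mangani` into a maximum, which is symmetric. -/
theorem sub_min_add (a b : ℝ) (ha : a ∈ Set.Icc 0 1) (hb : b ∈ Set.Icc 0 1) :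
    min 1 (1 - min 1 (1 - a + b) + b) = max a b := by
  obtain ⟨⟩ := ha
  obtain ⟨⟩ := hb
  simp only [min_def, max_def]; split_ifs <;> linarith

theorem laws_triangle : Laws Triangle where
  oplus_assoc a b c := Triangle.ext' (min_one_add_assoc a.1.1.2.1 c.1.1.2.1)
    (min_one_add_assoc a.1.2.2.1 c.1.2.2.1)
  oplus_comm a b := Triangle.ext' (congrArg (min 1) (add_comm _ _))
    (congrArg (min 1) (add_comm _ _))
  oplus_zero a := Triangle.ext' ((congrArg (min 1) (add_zero _)).trans (min_eq_right a.1.1.2.2))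
    ((congrArg (min 1) (add_zero _)).trans (min_eq_right a.1.2.2.2))
  oplus_neg_zero a := by
    have key (r : unitInterval) : min 1 ((r : ℝ) + (1 - 0)) = 1 - 0 := by
      rw [sub_zero, min_eq_left (le_add_of_nonneg_left r.2.1)]
    exact Triangle.ext' (key a.1.1) (key a.1.2)
  neg_neg a := Triangle.ext' (sub_sub_cancel _ _) (sub_sub_cancel _ _)
  mangani a b := by
    have key : min 1 (1 - min 1 (1 - (a.1.1 : ℝ) + b.1.1) + b.1.1) =
        min 1 (1 - min 1 (1 - (b.1.1 : ℝ) + a.1.1) + a.1.1) := by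
      rw [sub_min_add _ _ a.1.1.2 b.1.1.2, sub_min_add _ _ b.1.1.2 a.1.1.2, max_comm]
    exact Triangle.ext' key key
  odot_eq a b := by
    have key (r s : unitInterval) :
        max 0 ((r : ℝ) + s - 1) = 1 - min 1 (1 - (r : ℝ) + (1 - s)) := by
      rw [← max_sub_sub_left, sub_self]; congr 1; ring
    exact Triangle.ext' (key a.1.1 b.1.1) (key a.1.2 b.1.2)
  one_eq := Triangle.ext' (sub_zero 1).symm (sub_zero 1).symm
  nabla_eq a := Triangle.ext' (sub_sub_cancel _ _).symm (sub_sub_cancel _ _).symm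
  neg_iota := Triangle.ext' (sub_self 1) (sub_zero 1)
  delta_zero := rfl
  delta_one := rfl
  delta_iota := rfl
  delta_delta _ := rfl
  delta_nabla _ := rfl
  delta_oplus _ _ := rfl
  delta_odot _ _ := rfl
  order a := by
    have key : max 0 ((a.1.1 : ℝ) + (1 - a.1.2) - 1) = 0 := by
      have : (a.1.1 : ℝ) ≤ a.1.2 := a.2
      exact max_eq_left (by linarith)
    exact Triangle.ext' key key
  great a := by
    have h : (a.1.1 : ℝ) ≤ a.1.2 := a.2
    have h0 := a.1.1.2.1
    have h1 := a.1.2.2.2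
    -- In the lower coordinate `i` is 0 and kills the product; in the upper one it is 1, and the
    -- product is the length of the interval.
    refine Triangle.ext' (?_ : min 1 ((a.1.1 : ℝ) +
        max 0 (max 0 (0 + (a.1.2 : ℝ) - 1) + (1 - a.1.1) - 1)) = a.1.1)
      (?_ : min 1 ((a.1.1 : ℝ) +
        max 0 (max 0 (1 + (a.1.2 : ℝ) - 1) + (1 - a.1.1) - 1)) = a.1.2)
    · rw [max_eq_left (by linarith : 0 + (a.1.2 : ℝ) - 1 ≤ 0), max_eq_left (by linarith),
        add_zero, min_eq_right (by linarith)]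
    · rw [max_eq_right (by linarith : 0 ≤ 1 + (a.1.2 : ℝ) - 1), max_eq_right (by linarith),
        min_eq_right (by linarith)]
      ring

namespace Interval

theorem lo_mk {a b : unitInterval} (h : a ≤ b) : (mk a b h).lo = a :=
  (mk a b h).exists_isLeast.choose_spec.unique (isLeast_Icc h)

theorem hi_mk {a b : unitInterval} (h : a ≤ b) : (mk a b h).hi = b :=
  (mk a b h).exists_isGreatest.choose_spec.unique (isGreatest_Icc h)

theorem lo_le_hi (s : Interval) : s.lo ≤ s.hi :=
  s.exists_isLeast.choose_spec.2 s.exists_isGreatest.choose_spec.1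

theorem mk_lo_hi (s : Interval) : mk s.lo s.hi s.lo_le_hi = s := by
  obtain ⟨_, a, b, h, rfl⟩ := s
  have h1 : lo ⟨Set.Icc a b, a, b, h, rfl⟩ = a := lo_mk h
  have h2 : hi ⟨Set.Icc a b, a, b, h, rfl⟩ = b := hi_mk h
  apply Subtype.ext
  change Set.Icc _ _ = Set.Icc _ _
  rw [h1, h2]

theorem mk_congr {a b c d : unitInterval} {h : a ≤ b} {k : c ≤ d} (h1 : a = c) (h2 : b = d) :
    mk a b h = mk c d k := by
  subst h1 h2; rfl

/-- The isomorphism of the interval algebra with the triangle algebra. -/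
noncomputable def equivTriangle : Triangle ≃[lang] Interval where
  toFun p := mk p.1.1 p.1.2 p.2
  invFun s := Triangle.mk s.lo s.hi s.lo_le_hi
  left_inv p := Subtype.ext (Prod.ext (lo_mk p.2) (hi_mk p.2))
  right_inv s := s.mk_lo_hi
  map_fun' {n} f x := by
    cases f
    case zero => rfl
    case one => rfl
    case iota => exact Subtype.ext Set.Icc_bot_top
    case neg => exact Subtype.ext (image_mvNeg _ _).symm
    case delta => exact mk_congr (lo_mk (x 0).2).symm (lo_mk (x 0).2).symm
    case nabla => exact mk_congr (hi_mk (x 0).2).symm (hi_mk (x 0).2).symm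
    case oplus => exact Subtype.ext (image2_mvOplus (x 0).2 (x 1).2).symm
    case odot => exact Subtype.ext (image2_mvOdot (x 0).2 (x 1).2).symm
  map_rel' r := Empty.elim r

end Interval

end IMV

-- Equations under H, S and P, and algebras of term functions.

universe w

namespace IMV

section Preservation

variable {A : Type u} {B : Type v} [lang.Structure A] [lang.Structure B] {p q : Tm}

theorem Holds.of_surjective (h : Holds B p q) (f : B →[lang] A) (hf : Function.Surjective f) :
    Holds A p q := by
  intro v
  obtain ⟨w, rfl⟩ : ∃ w : ℕ → B, f ∘ w = v :=
    ⟨fun n => (hf (v n)).choose, funext fun n => (hf (v n)).choose_spec⟩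
  rw [HomClass.realize_term, HomClass.realize_term, h w]

theorem Holds.of_injective (h : Holds B p q) (f : A →[lang] B) (hf : Function.Injective f) :
    Holds A p q := by
  intro v
  apply hf
  rw [← HomClass.realize_term, ← HomClass.realize_term, h]

theorem realize_pi {ι : Type u} {C : ι → Type v} [∀ i, lang.Structure (C i)] {α : Type w}
    (t : lang.Term α) (x : α → ∀ i, C i) (i : ι) :
    t.realize x i = t.realize fun n => x n i := by
  induction t with
  | var => rfl
  | func f ts ih => exact congrArg (Structure.funMap f) (funext fun j => ih j)

theorem Holds.pi {ι : Type u} {C : ι → Type v} [∀ i, lang.Structure (C i)]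
    (h : ∀ i, Holds (C i) p q) : Holds (∀ i, C i) p q := by
  intro v
  funext i
  rw [realize_pi, realize_pi, h i]

end Preservation

theorem isIMVAlgebra_of_mem_classHSP {A : Type} [lang.Structure A] (hA : IsIMVAlgebra A)
    {J : CategoryTheory.Bundled.{u} lang.Structure} (hJ : J ∈ classHSP.{u} A) :
    IsIMVAlgebra J := by
  obtain ⟨B, ⟨C, ⟨ι, -, D, hD, ⟨e⟩⟩, S, ⟨g⟩⟩, f, hf⟩ := hJ
  intro p q h
  have hi (i : ι) : Holds (D i) p q := by
    have hDi : D i = CategoryTheory.Bundled.of (c := lang.Structure) A := hD i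
    rw [hDi]
    exact hA p q h
  have hC : Holds C p q := (Holds.pi hi).of_injective e.toHom e.injective
  have hS : Holds S p q := hC.of_injective S.subtype.toHom S.subtype.injective
  exact (hS.of_injective g.toHom g.injective).of_surjective f hf

/-- The subalgebra of term functions in a power of an algebra. -/
def termFunctions (A : Type v) [lang.Structure A] (α : Type u) :
    lang.Substructure ((α → A) → A) where
  carrier := Set.range fun (t : lang.Term α) w => t.realize w
  fun_mem f x hx := by
    choose ts hts using hx
    refine ⟨Term.func f ts, ?_⟩
    funext w
    exact congrArg (Structure.funMap f) (funext fun j => congrFun (hts j) w)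

/-- Term functions in variables indexed by `J` form the relatively free algebra. A term function
goes to the value of its term at the identity assignment; the hypothesis makes this well defined,
and coordinate projections hit every element. -/
theorem exists_hom_termFunctions {A : Type v} [lang.Structure A] {J : Type u} [lang.Structure J]
    (h : ∀ p q : lang.Term J, (∀ w : J → A, p.realize w = q.realize w) →
      p.realize (id : J → J) = q.realize id) :
    ∃ f : termFunctions A J →[lang] J, Function.Surjective f := by
  -- Some term representing `s` is chosen; `hF` shows that any other gives the same value.
  let F (s : termFunctions A J) : J := s.2.choose.realize id
  have hF (t : lang.Term J) (s : termFunctions A J) (hs : ∀ w, t.realize w = s.1 w) :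
      F s = t.realize id :=
    h _ _ fun w => (congrFun s.2.choose_spec w).trans (hs w).symm
  refine ⟨⟨F, fun {n} f x => ?_, fun r => Empty.elim r⟩, fun a => ?_⟩
  · refine hF (Term.func f fun i => (x i).2.choose) _ fun w => ?_
    exact congrArg (Structure.funMap f) (funext fun j => congrFun (x j).2.choose_spec w)
  · exact ⟨⟨fun w => w a, Term.var a, rfl⟩, hF (Term.var a) _ fun w => rfl⟩

theorem imvClass_eq_classHSP {A : Type} [lang.Structure A] (e : Triangle ≃[lang] A) :
    imvClass.{u} = classHSP.{u} A := by
  have hA : IsIMVAlgebra A := fun p q h =>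
    (laws_triangle.isIMVAlgebra p q h).of_injective e.symm.toHom e.symm.injective
  refine Set.Subset.antisymm (fun J hJ => ?_) fun J hJ => isIMVAlgebra_of_mem_classHSP hA hJ
  have hJ' : IsIMVAlgebra J := hJ
  obtain ⟨f, hf⟩ := exists_hom_termFunctions (A := A) (J := J) fun p q h => by
    by_contra hne
    obtain ⟨w, hw⟩ := hJ'.exists_triangle_realize_ne hne
    apply hw
    apply e.injective
    rw [← HomClass.realize_term, ← HomClass.realize_term, h]
  -- The index set of the power is `J → A`, which must be nonempty.
  have : Nonempty A := ⟨opZero A⟩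
  exact ⟨.of (termFunctions A J), ⟨.of ((J → A) → A), ⟨J → A, inferInstance,
    fun _ => .of A, fun _ => rfl, ⟨FirstOrder.Language.Equiv.refl lang _⟩⟩, termFunctions A J,
    ⟨FirstOrder.Language.Equiv.refl lang _⟩⟩, f, hf⟩

/-! ### Birkhoff equational logic -/

section Birkhoff

theorem Replace.holds {A : Type u} [lang.Structure A] {p q r s : Tm} (h : Replace p q r s)
    (hpq : Holds A p q) : Holds A r s := by
  induction h with
  | here => exact hpq
  | arg f ts i s _ ih =>
    intro v
    refine congrArg (Structure.funMap f) (funext fun j => ?_)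
    by_cases hj : j = i
    · subst hj
      rw [Function.update_self, ih v]
    · rw [Function.update_of_ne hj]

theorem Derivable.holds {E : Tm → Tm → Prop} {A : Type u} [lang.Structure A]
    (hA : ∀ p q, E p q → Holds A p q) {p q : Tm} (h : Derivable E p q) : Holds A p q := by
  induction h with
  | ax p q h => exact hA p q h
  | refl => exact fun _ => rfl
  | symm p q _ ih => exact fun v => (ih v).symm
  | trans p q r _ _ ih ih' => exact fun v => (ih v).trans (ih' v)
  | replacement p q r s _ h ih => exact h.holds ih
  | substitution p q σ _ ih =>
    intro v
    rw [Term.realize_subst, Term.realize_subst, ih]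

variable (E : Tm → Tm → Prop)

/-- The replacement rule changes one occurrence at a time, so the arguments are exchanged one by one
along a growing set of positions. -/
theorem Derivable.func {n : ℕ} (f : lang.Functions n) {a b : Fin n → Tm}
    (h : ∀ i, Derivable E (a i) (b i)) : Derivable E (Term.func f a) (Term.func f b) := by
  have key (s : Finset (Fin n)) :
      Derivable E (Term.func f a) (Term.func f (s.piecewise b a)) := by
    induction s using Finset.induction_on with
    | empty => rw [Finset.piecewise_empty]; exact .refl _
    | insert i s hi ih =>
      refine ih.trans _ _ _ ?_
      rw [Finset.piecewise_insert]
      refine .replacement _ _ _ _ (h i) (.arg f _ i _ ?_)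
      rw [Finset.piecewise_eq_of_notMem _ _ _ hi]
      exact .here
  have := key Finset.univ
  rwa [Finset.piecewise_univ] at this

/-- Provable equality of terms. -/
def derivableSetoid : Setoid Tm where
  r := Derivable E
  iseqv := ⟨.refl, .symm _ _, .trans _ _ _⟩

/-- The algebra of terms modulo provable equality. -/
def TermQuotient : Type := Quotient (derivableSetoid E)

variable {E} in
/-- The class of a term modulo provable equality. -/
def TermQuotient.mk (t : Tm) : TermQuotient E := Quotient.mk _ t

/-- Operations act on chosen representatives; that the choice is immaterial follows from
`Derivable.func`. -/
noncomputable instance : lang.Structure (TermQuotient E) where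
  funMap f x := Quotient.mk _ (Term.func f fun i => Quotient.out (x i))
  RelMap r _ := Empty.elim r

/-- Since evaluation is substitution, the substitution rule makes derivable equations hold in the
quotient, and the assignment of each variable to its own class shows that no others do. -/
theorem realize_termQuotient (t : Tm) (σ : ℕ → Tm) :
    t.realize (fun n => (TermQuotient.mk (σ n) : TermQuotient E)) =
      TermQuotient.mk (t.subst σ) := by
  induction t with
  | var => rfl
  | func f ts ih =>
    refine Quotient.sound (Derivable.func E f fun i => ?_)
    exact Quotient.exact ((Quotient.out_eq _).trans (ih i))

theorem Derivable.holds_termQuotient {p q : Tm} (h : Derivable E p q) :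
    Holds (TermQuotient E) p q := by
  intro v
  obtain ⟨σ, rfl⟩ : ∃ σ : ℕ → Tm, (fun n => TermQuotient.mk (σ n)) = v :=
    ⟨fun n => Quotient.out (v n), funext fun n => Quotient.out_eq _⟩
  rw [realize_termQuotient, realize_termQuotient]
  exact Quotient.sound (h.substitution _ _ σ)

theorem derivable_of_holds_termQuotient {p q : Tm} (h : Holds (TermQuotient E) p q) :
    Derivable E p q := by
  have := h fun n => TermQuotient.mk (Term.var n)
  rw [realize_termQuotient, realize_termQuotient] at this
  have hs (t : Tm) : t.subst Term.var = t := by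
    induction t with
    | var => rfl
    | func f ts ih => exact congrArg (Term.func f) (funext ih)
  rw [hs, hs] at this
  exact Quotient.exact this

end Birkhoff

theorem IsIMVAlgebra.holds_of_holds_triangle {J : Type u} [lang.Structure J]
    (hJ : IsIMVAlgebra J) {p q : Tm} (h : Holds Triangle p q) : Holds J p q := by
  intro v
  by_contra hne
  obtain ⟨w, hw⟩ := hJ.exists_triangle_realize_ne hne
  exact hw (h w)

end IMV

theorem theorem5p1 :
    (∃ ω : IMV.Interval ≃[IMV.lang] IMV.Triangle,
        ∀ (a b : unitInterval) (h : a ≤ b), ω (IMV.Interval.mk a b h) = IMV.Triangle.mk a b h) ∧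
      IMV.IsIMVAlgebra IMV.Interval ∧
      IMV.IsIMVAlgebra IMV.Triangle ∧
      IMV.imvClass.{u} = IMV.classHSP.{u} IMV.Interval ∧
      IMV.classHSP.{u} IMV.Interval = IMV.classHSP.{u} IMV.Triangle ∧
      ∀ p q : IMV.Tm,
        ((∀ (J : Type u) [IMV.lang.Structure J], IMV.IsIMVAlgebra J → IMV.Holds J p q) ↔
            IMV.Holds IMV.Interval p q) ∧
          (IMV.Holds IMV.Interval p q ↔ IMV.Derivable IMV.Ax p q) := by
  let e := IMV.Interval.equivTriangle
  have hT : IMV.IsIMVAlgebra IMV.Triangle := IMV.laws_triangle.isIMVAlgebra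
  have hI : IMV.IsIMVAlgebra IMV.Interval := fun p q h =>
    (hT p q h).of_injective e.symm.toHom e.symm.injective
  have hIT {p q : IMV.Tm} (h : IMV.Holds IMV.Interval p q) : IMV.Holds IMV.Triangle p q :=
    h.of_injective e.toHom e.injective
  have hHSP := IMV.imvClass_eq_classHSP.{u} e
  refine ⟨⟨e.symm, fun a b h => e.symm_apply_apply (IMV.Triangle.mk a b h)⟩, hI, hT, hHSP,
    hHSP.symm.trans (IMV.imvClass_eq_classHSP (.refl _ _)),
    fun p q => ⟨⟨fun h => ?_, fun h J _ hJ => hJ.holds_of_holds_triangle (hIT h)⟩,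
      fun h => ?_, fun h => h.holds hI⟩⟩
  -- The power over a one-point index moves the interval algebra into universe `u`; evaluation at
  -- the point maps it back onto the intervals.
  · have hP : IMV.IsIMVAlgebra (PUnit.{u + 1} → IMV.Interval) :=
      fun p q hpq => .pi fun _ => hI p q hpq
    exact (h _ hP).of_surjective ⟨fun a => a ⟨⟩, fun _ _ => rfl, fun r => Empty.elim r⟩
      fun a => ⟨fun _ => a, rfl⟩
  -- The term quotient is itself an IMV-algebra, so an equation true in the triangle holds there and
  -- is therefore derivable.
  · have hQ : IMV.IsIMVAlgebra (IMV.TermQuotient IMV.Ax) := fun p q hpq =>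
      (IMV.Derivable.ax p q hpq).holds_termQuotient
    exact IMV.derivable_of_holds_termQuotient _ (hQ.holds_of_holds_triangle (hIT h))
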